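/- **Theorem (productivity of Async RaTT).** *Types and contexts.* Types are $A,B ::= \alpha \mid 1 \mid \mathrm{Nat} \mid A\times B \mid A+B \mid A\to B \mid \exists\!\bigcirc A \mid \forall\!\bigcirc A \mid \mathrm{Fix}\,\alpha.A \mid \Box A$ (here $\exists\!\bigcirc$ and $\forall\!\bigcirc$ are the delay modalities on an existentially, respectively universally, quantified clock). *Stable* types are built from $1$, $\mathrm{Nat}$, and all types $\forall\!\bigcirc A$, $\Box A$ by $\times,+$; *value types* are built from $1,\mathrm{Nat}$ by $\times,+$. Put $\mathrm{Sig}\,A=\mathrm{Fix}\,\alpha.(A\times\alpha)$. An input context $\Delta$ declares input channels $\kappa:_c A$, each with one class $c\in\{\mathsf p,\mathsf b,\mathsf{bp}\}$ and one value type $A$; $\kappa$ is a *push* channel if $c\in\{\mathsf p,\mathsf{bp}\}$ and *buffered* if $c\in\{\mathsf b,\mathsf{bp}\}$. An output context $\Gamma_{\rm out}=x_1:A_1,\dots,x_m:A_m$ declares distinct output channels with value types. A typing context $\Gamma$ consists of variables $x:A$ and at most one tick $\checkmark_\theta$, where $\theta$ is a clock expression over the variables to the left of the tick. *Terms.* Terms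 are those of the $\lambda$-calculus with $\mathsf{let}$, unit, $0$, $\mathsf{suc}$, primitive recursion on $\mathrm{Nat}$, pairs, projections, injections and case distinction, together with heap locations $l$, $\mathsf{inp}_\kappa$ (the next input on $\kappa$), $\mathsf{buf}_\kappa$ (the current value of $\kappa$), $\mathsf{delay}_\theta\,t$, $\mathsf{adv}\,t$, $\mathsf{select}\,v_1\,v_2$, $\mathsf{never}$, $\mathsf{box}\,t$, $\mathsf{unbox}\,t$, $\mathsf{fix}\,x.t$, $\mathsf{dfix}\,x.t$, $\mathsf{into}\,t$, $\mathsf{out}\,t$. Values are variables, $()$, $0$, $\lambda x.t$, $l$, $\mathsf{inp}_\kappa$, $\mathsf{box}\,t$, $\mathsf{dfix}\,x.t$, closed under $\mathsf{suc}$, pairing, injections and $\mathsf{into}$. Clock expressions are $\theta ::= \mathsf{cl}(v)\mid\theta\sqcup\theta'$ with $v$ a value; $\mathsf{cl}(v)$ is well-formed in $\Gamma$ if $\Gamma\vdash v:\exists\!\bigcirc A$ for some $A$. *Typing $\Gamma\vdash_\Delta t:A$.* The rules for the standard constructs are the usual ones, except that a variable to the left of a tick may be used to the right of it only if its type is stable,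 and $\lambda x.t$ may be formed only in tick-free contexts. Let $\Gamma^\Box$ be $\Gamma$ without ticks and without variables of non-stable type. The other rules are: - $\mathsf{never}:\exists\!\bigcirc A$; $\mathsf{inp}_\kappa:\exists\!\bigcirc A$ if $\kappa:_cA\in\Delta$ is a push channel; $\mathsf{buf}_\kappa:A$ if $\kappa:_cA\in\Delta$ is buffered; - $\Gamma\vdash\mathsf{delay}_\theta\,t:\exists\!\bigcirc A$ if $\Gamma$ is tick-free, $\theta$ is well-formed in $\Gamma$, and $\Gamma,\checkmark_\theta\vdash t:A$; - $\Gamma,\checkmark_{\mathsf{cl}(v)},\Gamma'\vdash\mathsf{adv}\,v:A$ if $v$ is a value with $\Gamma\vdash v:\exists\!\bigcirc A$; and $\Gamma,\checkmark_\theta,\Gamma'\vdash\mathsf{adv}\,x:A$ if $\Gamma\vdash x:\forall\!\bigcirc A$ for a variable $x$; - $\Gamma,\checkmark_\theta,\Gamma'\vdash\mathsf{select}\,v_1\,v_2:((A_1\times\exists\!\bigcirc A_2)+(\exists\!\bigcirc A_1\times A_2))+(A_1\times A_2)$ if $v_1,v_2$ are values, $\Gamma\vdash v_i:\exists\!\bigcirc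 A_i$, and $\theta=\mathsf{cl}(v_1)\sqcup\mathsf{cl}(v_2)$ modulo associativity, commutativity and idempotence of $\sqcup$; - $\Gamma\vdash\mathsf{fix}\,x.t:A$ if $\Gamma^\Box,x:\forall\!\bigcirc A\vdash t:A$; $\Gamma\vdash\mathsf{box}\,t:\Box A$ if $\Gamma^\Box\vdash t:A$; $\mathsf{unbox}\,t:A$ if $t:\Box A$; $\mathsf{into}$ and $\mathsf{out}$ map between $A[\exists\!\bigcirc(\mathrm{Fix}\,\alpha.A)/\alpha]$ and $\mathrm{Fix}\,\alpha.A$. There are no rules for $l$ and $\mathsf{dfix}$. A *reactive program* $t:\Delta\Rightarrow\Gamma_{\rm out}$ is a term with $\cdot\vdash_\Delta t:\mathrm{Sig}\,A_1\times\dots\times\mathrm{Sig}\,A_m$ (binary products nested to the left, $1$ if $m=0$). *Evaluation.* A clock is a finite set of channels. Each location $l$ has a clock $\mathsf{cl}(l)$, and each clock has countably infinitely many locations. Put $|\mathsf{cl}(l)|=\mathsf{cl}(l)$, $|\mathsf{cl}(\mathsf{inp}_\kappa)|=\{\kappa\}$, $|\theta\sqcup\theta'|=|\theta|\cup|\theta'|$.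 A heap is a finite map from locations to terms. A store $\sigma$ is a heap $\eta_L$ or has the form $\eta_N\langle\kappa\mapsto v\rangle\eta_L$; $\eta_L$ is its later heap. Fix any function $\mathsf{alloc}$ that returns, for a clock $\Theta$ and a store with later heap $\eta_L$, a location $l\notin\mathrm{dom}\,\eta_L$ with $\mathsf{cl}(l)=\Theta$. An input buffer $\iota$ is a partial map from channels to terms. The relation $\langle t;\sigma\rangle\Downarrow_\iota\langle v;\sigma'\rangle$ is the call-by-value, left-to-right big-step evaluation (values evaluate to themselves without changing the store; $\mathsf{out}(\mathsf{into}\,v)$ yields $v$; $\mathsf{unbox}$ evaluates the boxed term; $\mathsf{fix}\,x.t$ evaluates $t[\mathsf{dfix}\,x.t/x]$), and - $\mathsf{buf}_\kappa$ yields $\iota(\kappa)$ if $\kappa\in\mathrm{dom}\,\iota$; $\mathsf{delay}_\theta\,t$ yields $l=\mathsf{alloc}(|\theta|,\sigma)$ and extends the later heap by $l\mapsto t$; $\mathsf{never}$ yields $\mathsf{alloc}(\emptyset,\sigma)$ and leaves the store unchanged; - in a store $\eta_N\langle\kappa\mapsto v\rangle\eta_L$, $\mathsf{adv}\,\mathsf{inp}_\kappa$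 yields $v$ and $\mathsf{adv}\,l$ evaluates $\eta_N(l)$; in any store, $\mathsf{adv}(\mathsf{dfix}\,x.t)$ evaluates $t[\mathsf{dfix}\,x.t/x]$; - in a store $\eta_N\langle\kappa\mapsto w\rangle\eta_L$, $\mathsf{select}\,v_1\,v_2$ evaluates $\mathsf{adv}\,v_i$ for those $i$ with $\kappa\in|\mathsf{cl}(v_i)|$ (at least one, in the order $1,2$), giving $u_i$, and yields $\mathsf{in}_1(\mathsf{in}_1(u_1,v_2))$, $\mathsf{in}_1(\mathsf{in}_2(v_1,u_2))$ or $\mathsf{in}_2(u_1,u_2)$ if this set of indices is $\{1\}$, $\{2\}$ or $\{1,2\}$. *Reactive machine.* Write $v::l$ for $\mathsf{into}(v,l)$. The machine has the following transitions between states $\langle t;\iota\rangle$ and $\langle N;\sigma;\iota\rangle$, where $N$ is a sequence $x_1\mapsto l_1,\dots,x_n\mapsto l_n$. - *Initialisation:* if $\langle t;\emptyset\rangle\Downarrow_\iota\langle(v_1::l_1,\dots,v_m::l_m);\eta\rangle$, then $\langle t;\iota\rangle\xrightarrow{O}\langle x_1\mapsto l_1,\dots,x_m\mapsto l_m;\eta;\iota\rangle$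 with $O=(x_1\mapsto v_1,\dots,x_m\mapsto v_m)$. - *Input:* $\langle N;\eta;\iota\rangle\xrightarrow{\kappa\mapsto v}\langle N;\eta_{\ni\kappa}\langle\kappa\mapsto v\rangle\eta_{\not\ni\kappa};\iota'\rangle$, where $\eta$ is split according to whether $\kappa\in\mathsf{cl}(l)$, and $\iota'=\iota[\kappa\mapsto v]$ if $\kappa\in\mathrm{dom}\,\iota$, $\iota'=\iota$ otherwise. - *Output:* from $\langle N;\eta_N\langle\kappa\mapsto v\rangle\eta_L;\iota\rangle$ the entries $x\mapsto l$ of $N$ are processed from left to right. If $\kappa\notin\mathsf{cl}(l)$ the entry is kept and gives no output. If $\kappa\in\mathsf{cl}(l)$, then $\mathsf{adv}\,l$ is evaluated in the current store to a value $v'::l'$, the entry becomes $x\mapsto l'$, and $x\mapsto v'$ is added to $O$. At the end everything but the later heap of the store is deleted. The transition is $\langle N;\eta_N\langle\kappa\mapsto v\rangle\eta_L;\iota\rangle\xrightarrow{O}\langle N';\eta';\iota\rangle$ with the new sequence $N'$ and that later heap $\eta'$. *Well-typedness.* Write $\vdash v:A$ if $v$ is a value of type $A$ in the empty typing context and the empty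 input context. An input buffer $\iota$ is well-typed, $\vdash\iota:\Delta$, if for every buffered $\kappa:_cA\in\Delta$ the value $\iota(\kappa)$ is defined and $\vdash\iota(\kappa):A$. An input is well-typed, $\vdash\kappa\mapsto v:\Delta$, if $\kappa:_cA\in\Delta$ and $\vdash v:A$ for some $c, A$. Outputs are well-typed, $\vdash O:\Gamma_{\rm out}$, if for every $x\mapsto v$ in $O$ there is $x:A\in\Gamma_{\rm out}$ with $\vdash v:A$. *Claim.* Let $t:\Delta\Rightarrow\Gamma_{\rm out}$ be a reactive program, let $\vdash\kappa_i\mapsto v_i:\Delta$ for all $i\in\mathbb N$, and let $\vdash\iota_0:\Delta$. Then there is an infinite transition sequence $$\langle t;\iota_0\rangle\xrightarrow{O_0}\langle N_0;\eta_0;\iota_0\rangle\xrightarrow{\kappa_0\mapsto v_0}\langle N_0;\sigma_0;\iota_1\rangle\xrightarrow{O_1}\langle N_1;\eta_1;\iota_1\rangle\xrightarrow{\kappa_1\mapsto v_1}\cdots$$ with $\vdash O_i:\Gamma_{\rm out}$ for all $i\in\mathbb N$. -/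

import Mathlib

/-!  Async RaTT: syntax, type system, evaluation semantics and reactive semantics.

Binding is represented by de Bruijn indices, so terms and types are taken up to renaming of bound
variables by construction. -/

namespace AsyncRaTT

/-! ### Channels, locations, clocks -/

/-- Names of input channels. -/
abbrev Chan := ℕ

/-- Names of output channels. -/
abbrev OutChan := ℕ

/-- A clock is a finite set of channels; it ticks when one of them is updated. -/
abbrev Clock := Finset Chan

/-- Heap locations: every clock has countably infinitely many locations. -/
abbrev Loc := Clock × ℕ

/-- The clock `cl(l)` of a location. -/
def Loc.clock (l : Loc) : Clock := l.1

/-! ### Types -/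

inductive Ty : Type
  /-- a type variable (de Bruijn index) -/
  | tvar (i : ℕ)
  | unit
  | nat
  | prod (A B : Ty)
  | sum (A B : Ty)
  | arr (A B : Ty)
  /-- delay on an existentially quantified clock -/
  | delayE (A : Ty)
  /-- delay on a universally quantified clock -/
  | delayA (A : Ty)
  /-- guarded recursive type; binds the type variable `0` in `A` -/
  | fix (A : Ty)
  | box (A : Ty)

/-- Lifting of a renaming of indices under one binder. -/
def liftRen (ρ : ℕ → ℕ) : ℕ → ℕ
  | 0 => 0
  | n + 1 => ρ n + 1

namespace Ty

def rename : (ℕ → ℕ) → Ty → Ty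
  | ρ, tvar i => tvar (ρ i)
  | _, unit => unit
  | _, nat => nat
  | ρ, prod A B => prod (rename ρ A) (rename ρ B)
  | ρ, sum A B => sum (rename ρ A) (rename ρ B)
  | ρ, arr A B => arr (rename ρ A) (rename ρ B)
  | ρ, delayE A => delayE (rename ρ A)
  | ρ, delayA A => delayA (rename ρ A)
  | ρ, fix A => fix (rename (liftRen ρ) A)
  | ρ, box A => box (rename ρ A)

/-- Lifting of a simultaneous type substitution under one binder. -/
def up (s : ℕ → Ty) : ℕ → Ty
  | 0 => tvar 0
  | n + 1 => rename Nat.succ (s n)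

/-- Simultaneous capture-avoiding substitution. -/
def subst : (ℕ → Ty) → Ty → Ty
  | s, tvar i => s i
  | _, unit => unit
  | _, nat => nat
  | s, prod A B => prod (subst s A) (subst s B)
  | s, sum A B => sum (subst s A) (subst s B)
  | s, arr A B => arr (subst s A) (subst s B)
  | s, delayE A => delayE (subst s A)
  | s, delayA A => delayA (subst s A)
  | s, fix A => fix (subst (up s) A)
  | s, box A => box (subst s A)

/-- `A.inst B` is `A[B/α]`, where `α` is the type variable `0` of `A`. -/
def inst (A B : Ty) : Ty :=
  subst (fun n => match n with
    | 0 => B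
    | n + 1 => tvar n) A

/-- The unfolding `A[DelayE (Fix α. A)/α]` of `Fix α. A`. -/
def unfold (A : Ty) : Ty := A.inst (delayE (fix A))

/-- The type of signals, `Sig A = Fix α. (A × α)`. -/
def sig (A : Ty) : Ty := fix (prod (rename Nat.succ A) (tvar 0))

/-- Stable types. -/
def stable : Ty → Bool
  | unit => true
  | nat => true
  | prod A B => stable A && stable B
  | sum A B => stable A && stable B
  | delayA _ => true
  | box _ => true
  | tvar _ => false
  | arr _ _ => false
  | delayE _ => false
  | fix _ => false

/-- Value types. -/
inductive IsValueType : Ty → Prop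
  | unit : IsValueType unit
  | nat : IsValueType nat
  | prod {A B : Ty} : IsValueType A → IsValueType B → IsValueType (prod A B)
  | sum {A B : Ty} : IsValueType A → IsValueType B → IsValueType (sum A B)

/-- The `n`-ary product `A₁ × ⋯ × Aₙ`, encoded by left-nested binary products; the product of no
types is `unit` and the product of a single type is that type. -/
def tupleTy : List Ty → Ty
  | [] => unit
  | A :: As => As.foldl prod A

end Ty

/-! ### Terms and clock expressions -/

mutual

/-- Terms. -/
inductive Tm : Type
  /-- a variable (de Bruijn index) -/
  | var (i : ℕ)
  | unit
  | zero
  | suc (t : Tm)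
  /-- `rec_Nat(s, x y. t, u)`; in `t`, the index `1` is the predecessor `x` and the index `0` is the
  recursive result `y` -/
  | recN (s t u : Tm)
  | lam (t : Tm)
  | app (s t : Tm)
  | pair (s t : Tm)
  | fst (t : Tm)
  | snd (t : Tm)
  | inl (t : Tm)
  | inr (t : Tm)
  /-- case distinction; both branches bind one variable -/
  | case (t t₁ t₂ : Tm)
  /-- `let x = s in t`; `t` binds one variable -/
  | letin (s t : Tm)
  /-- a heap location -/
  | loc (l : Loc)
  /-- the delayed next input on a push channel -/
  | inp (κ : Chan)
  /-- the current value of a buffered channel -/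
  | buf (κ : Chan)
  | delay (θ : Clk) (t : Tm)
  | adv (t : Tm)
  | select (v₁ v₂ : Tm)
  | never
  | box (t : Tm)
  | unbox (t : Tm)
  /-- fixed point; binds one variable -/
  | fix (t : Tm)
  /-- delayed fixed point; binds one variable -/
  | dfix (t : Tm)
  | into (t : Tm)
  | out (t : Tm)

/-- Clock expressions. -/
inductive Clk : Type
  | cl (v : Tm)
  | join (θ θ' : Clk)

end

/-- Values. -/
inductive IsValue : Tm → Prop
  | var {i : ℕ} : IsValue (.var i)
  | unit : IsValue .unit
  | zero : IsValue .zero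
  | suc {v : Tm} : IsValue v → IsValue (.suc v)
  | lam {t : Tm} : IsValue (.lam t)
  | pair {v w : Tm} : IsValue v → IsValue w → IsValue (.pair v w)
  | inl {v : Tm} : IsValue v → IsValue (.inl v)
  | inr {v : Tm} : IsValue v → IsValue (.inr v)
  | loc {l : Loc} : IsValue (.loc l)
  | inp {κ : Chan} : IsValue (.inp κ)
  | box {t : Tm} : IsValue (.box t)
  | dfix {t : Tm} : IsValue (.dfix t)
  | into {v : Tm} : IsValue v → IsValue (.into v)

mutual

def Tm.rename : (ℕ → ℕ) → Tm → Tm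
  | ρ, .var i => .var (ρ i)
  | _, .unit => .unit
  | _, .zero => .zero
  | ρ, .suc t => .suc (Tm.rename ρ t)
  | ρ, .recN s t u =>
      .recN (Tm.rename ρ s) (Tm.rename (liftRen (liftRen ρ)) t) (Tm.rename ρ u)
  | ρ, .lam t => .lam (Tm.rename (liftRen ρ) t)
  | ρ, .app s t => .app (Tm.rename ρ s) (Tm.rename ρ t)
  | ρ, .pair s t => .pair (Tm.rename ρ s) (Tm.rename ρ t)
  | ρ, .fst t => .fst (Tm.rename ρ t)
  | ρ, .snd t => .snd (Tm.rename ρ t)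
  | ρ, .inl t => .inl (Tm.rename ρ t)
  | ρ, .inr t => .inr (Tm.rename ρ t)
  | ρ, .case t t₁ t₂ =>
      .case (Tm.rename ρ t) (Tm.rename (liftRen ρ) t₁) (Tm.rename (liftRen ρ) t₂)
  | ρ, .letin s t => .letin (Tm.rename ρ s) (Tm.rename (liftRen ρ) t)
  | _, .loc l => .loc l
  | _, .inp κ => .inp κ
  | _, .buf κ => .buf κ
  | ρ, .delay θ t => .delay (Clk.rename ρ θ) (Tm.rename ρ t)
  | ρ, .adv t => .adv (Tm.rename ρ t)
  | ρ, .select v₁ v₂ => .select (Tm.rename ρ v₁) (Tm.rename ρ v₂)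
  | _, .never => .never
  | ρ, .box t => .box (Tm.rename ρ t)
  | ρ, .unbox t => .unbox (Tm.rename ρ t)
  | ρ, .fix t => .fix (Tm.rename (liftRen ρ) t)
  | ρ, .dfix t => .dfix (Tm.rename (liftRen ρ) t)
  | ρ, .into t => .into (Tm.rename ρ t)
  | ρ, .out t => .out (Tm.rename ρ t)

def Clk.rename : (ℕ → ℕ) → Clk → Clk
  | ρ, .cl v => .cl (Tm.rename ρ v)
  | ρ, .join θ θ' => .join (Clk.rename ρ θ) (Clk.rename ρ θ')

end

/-- Extension of a simultaneous substitution by a term for the index `0`. -/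
def scons (v : Tm) (s : ℕ → Tm) : ℕ → Tm
  | 0 => v
  | n + 1 => s n

/-- Lifting of a simultaneous substitution under one binder. -/
def up (s : ℕ → Tm) : ℕ → Tm := scons (.var 0) (fun n => (s n).rename Nat.succ)

mutual

/-- Simultaneous capture-avoiding substitution. -/
def Tm.subst : (ℕ → Tm) → Tm → Tm
  | s, .var i => s i
  | _, .unit => .unit
  | _, .zero => .zero
  | s, .suc t => .suc (Tm.subst s t)
  | s, .recN r t u => .recN (Tm.subst s r) (Tm.subst (up (up s)) t) (Tm.subst s u)
  | s, .lam t => .lam (Tm.subst (up s) t)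
  | s, .app r t => .app (Tm.subst s r) (Tm.subst s t)
  | s, .pair r t => .pair (Tm.subst s r) (Tm.subst s t)
  | s, .fst t => .fst (Tm.subst s t)
  | s, .snd t => .snd (Tm.subst s t)
  | s, .inl t => .inl (Tm.subst s t)
  | s, .inr t => .inr (Tm.subst s t)
  | s, .case t t₁ t₂ => .case (Tm.subst s t) (Tm.subst (up s) t₁) (Tm.subst (up s) t₂)
  | s, .letin r t => .letin (Tm.subst s r) (Tm.subst (up s) t)
  | _, .loc l => .loc l
  | _, .inp κ => .inp κ
  | _, .buf κ => .buf κ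
  | s, .delay θ t => .delay (Clk.subst s θ) (Tm.subst s t)
  | s, .adv t => .adv (Tm.subst s t)
  | s, .select v₁ v₂ => .select (Tm.subst s v₁) (Tm.subst s v₂)
  | _, .never => .never
  | s, .box t => .box (Tm.subst s t)
  | s, .unbox t => .unbox (Tm.subst s t)
  | s, .fix t => .fix (Tm.subst (up s) t)
  | s, .dfix t => .dfix (Tm.subst (up s) t)
  | s, .into t => .into (Tm.subst s t)
  | s, .out t => .out (Tm.subst s t)

def Clk.subst : (ℕ → Tm) → Clk → Clk
  | s, .cl v => .cl (Tm.subst s v)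
  | s, .join θ θ' => .join (Clk.subst s θ) (Clk.subst s θ')

end

/-- `t.inst v` is `t[v/x]`, where `x` is the variable `0` of `t`. -/
def Tm.inst (t v : Tm) : Tm := t.subst (scons v .var)

/-- `t.inst₂ v w` is `t[v/x, w/y]`, where `x` is the variable `1` and `y` the variable `0`. -/
def Tm.inst₂ (t v w : Tm) : Tm := t.subst (scons w (scons v .var))

/-- `s :: t` is `into ⟨s, t⟩`. -/
def Tm.cons (s t : Tm) : Tm := .into (.pair s t)

/-- The tuple `⟨t₁, …, tₙ⟩` that goes with the product type `Ty.tupleTy`. -/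
def Tm.tuple : List Tm → Tm
  | [] => .unit
  | t :: ts => ts.foldl .pair t

/-- Equality of clock expressions modulo associativity, commutativity and idempotence of `⊔`. -/
inductive ClkEq : Clk → Clk → Prop
  | refl (θ : Clk) : ClkEq θ θ
  | symm {θ θ' : Clk} : ClkEq θ θ' → ClkEq θ' θ
  | trans {θ θ' θ'' : Clk} : ClkEq θ θ' → ClkEq θ' θ'' → ClkEq θ θ''
  | congr {θ₁ θ₁' θ₂ θ₂' : Clk} :
      ClkEq θ₁ θ₁' → ClkEq θ₂ θ₂' → ClkEq (.join θ₁ θ₂) (.join θ₁' θ₂')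
  | assoc (θ₁ θ₂ θ₃ : Clk) : ClkEq (.join (.join θ₁ θ₂) θ₃) (.join θ₁ (.join θ₂ θ₃))
  | comm (θ₁ θ₂ : Clk) : ClkEq (.join θ₁ θ₂) (.join θ₂ θ₁)
  | idem (θ : Clk) : ClkEq (.join θ θ) θ

/-! ### Input contexts and typing contexts -/

/-- The three classes of input channels: push-only, buffered-only, buffered-push. -/
inductive ChanClass : Type
  | p
  | b
  | bp

def ChanClass.IsPush (c : ChanClass) : Prop := c = .p ∨ c = .bp

def ChanClass.IsBuffered (c : ChanClass) : Prop := c = .b ∨ c = .bp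

/-- An input context `Δ`: it declares channels, each with one class and one value type. -/
structure InputCtx where
  decl : Chan → Option (ChanClass × Ty)
  isValueType : ∀ κ c A, decl κ = some (c, A) → A.IsValueType

/-- `Δ.Has κ c A` is `κ :_c A ∈ Δ`. -/
def InputCtx.Has (Δ : InputCtx) (κ : Chan) (c : ChanClass) (A : Ty) : Prop :=
  Δ.decl κ = some (c, A)

/-- The empty input context. -/
def InputCtx.empty : InputCtx where
  decl _ := none
  isValueType := by intro κ c A h; cases h

/-- An output context `Γout`: a sequence of distinct output channels with value types. -/
structure OutputCtx where
  decls : List (OutChan × Ty)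
  nodup : (decls.map Prod.fst).Nodup
  isValueType : ∀ x A, (x, A) ∈ decls → A.IsValueType

/-- The type `Prod Γout = Sig A₁ × ⋯ × Sig Aₙ`. -/
def OutputCtx.prodTy (Γ : OutputCtx) : Ty :=
  Ty.tupleTy (Γ.decls.map fun d => d.2.sig)

/-- Entries of a typing context: variable declarations and ticks. -/
inductive Entry : Type
  | var (A : Ty)
  | tick (θ : Clk)

/-- Typing contexts; the head of the list is the rightmost entry, so `Γ, e` is `e :: Γ` and `Γ, Γ'`
is `Γ' ++ Γ`. The variables are numbered from the right; ticks are not counted. A tick's clock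
expression is numbered relative to the part of the context to the left of the tick. -/
abbrev Ctx := List Entry

namespace Ctx

def TickFree (Γ : Ctx) : Prop := ∀ θ, Entry.tick θ ∉ Γ

/-- The number of variables declared in a context. -/
def nvars : Ctx → ℕ
  | [] => 0
  | .var _ :: Γ => nvars Γ + 1
  | .tick _ :: Γ => nvars Γ

/-- The stabilisation of a context: all ticks and all variables of non-stable type are removed. -/
def stab : Ctx → Ctx
  | [] => []
  | .var A :: Γ => if A.stable then .var A :: stab Γ else stab Γ
  | .tick _ :: Γ => stab Γ

/-- The index in `Γ` of a variable that is given by its index in `stab Γ`. -/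
def stabRen : Ctx → ℕ → ℕ
  | [] => id
  | .var A :: Γ => if A.stable then liftRen (stabRen Γ) else fun n => stabRen Γ n + 1
  | .tick _ :: Γ => stabRen Γ

end Ctx

/-! ### Typing rules

A term that is typed in a part `Γ` of a context `Γ' ++ e :: Γ`, or in `stab Γ`, is renamed where it is
used in the whole context; this is the index bookkeeping for leaving a named term unchanged. -/

mutual

/-- `HasType Δ Γ t A` is `Γ ⊢_Δ t : A`. -/
inductive HasType (Δ : InputCtx) : Ctx → Tm → Ty → Prop
  | var {Γ Γ' : Ctx} {A : Ty} :
      Γ'.TickFree ∨ A.stable = true → WfCtx Δ (Γ' ++ .var A :: Γ) →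
      HasType Δ (Γ' ++ .var A :: Γ) (.var Γ'.nvars) A
  | unit {Γ : Ctx} : HasType Δ Γ .unit .unit
  | letin {Γ : Ctx} {s t : Tm} {A B : Ty} :
      HasType Δ Γ s A → HasType Δ (.var A :: Γ) t B → HasType Δ Γ (.letin s t) B
  | lam {Γ : Ctx} {t : Tm} {A B : Ty} :
      HasType Δ (.var A :: Γ) t B → Γ.TickFree → HasType Δ Γ (.lam t) (.arr A B)
  | app {Γ : Ctx} {t t' : Tm} {A B : Ty} :
      HasType Δ Γ t (.arr A B) → HasType Δ Γ t' A → HasType Δ Γ (.app t t') B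
  | inl {Γ : Ctx} {t : Tm} {A B : Ty} :
      HasType Δ Γ t A → HasType Δ Γ (.inl t) (.sum A B)
  | inr {Γ : Ctx} {t : Tm} {A B : Ty} :
      HasType Δ Γ t B → HasType Δ Γ (.inr t) (.sum A B)
  | case {Γ : Ctx} {t t₁ t₂ : Tm} {A₁ A₂ B : Ty} :
      HasType Δ (.var A₁ :: Γ) t₁ B → HasType Δ (.var A₂ :: Γ) t₂ B →
      HasType Δ Γ t (.sum A₁ A₂) → HasType Δ Γ (.case t t₁ t₂) B
  | pair {Γ : Ctx} {t t' : Tm} {A B : Ty} :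
      HasType Δ Γ t A → HasType Δ Γ t' B → HasType Δ Γ (.pair t t') (.prod A B)
  | fst {Γ : Ctx} {t : Tm} {A B : Ty} :
      HasType Δ Γ t (.prod A B) → HasType Δ Γ (.fst t) A
  | snd {Γ : Ctx} {t : Tm} {A B : Ty} :
      HasType Δ Γ t (.prod A B) → HasType Δ Γ (.snd t) B
  | delay {Γ : Ctx} {θ : Clk} {t : Tm} {A : Ty} :
      HasType Δ (.tick θ :: Γ) t A → IsClock Δ Γ θ → Γ.TickFree →
      HasType Δ Γ (.delay θ t) (.delayE A)
  | never {Γ : Ctx} {A : Ty} : HasType Δ Γ .never (.delayE A)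
  | inp {Γ : Ctx} {κ : Chan} {c : ChanClass} {A : Ty} :
      Δ.Has κ c A → c.IsPush → HasType Δ Γ (.inp κ) (.delayE A)
  | buf {Γ : Ctx} {κ : Chan} {c : ChanClass} {A : Ty} :
      Δ.Has κ c A → c.IsBuffered → HasType Δ Γ (.buf κ) A
  | adv {Γ Γ' : Ctx} {v : Tm} {A : Ty} :
      IsValue v → HasType Δ Γ v (.delayE A) → WfCtx Δ (Γ' ++ .tick (.cl v) :: Γ) →
      HasType Δ (Γ' ++ .tick (.cl v) :: Γ) (.adv (v.rename (· + Γ'.nvars))) A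
  | advVar {Γ Γ' : Ctx} {θ : Clk} {i : ℕ} {A : Ty} :
      HasType Δ Γ (.var i) (.delayA A) → WfCtx Δ (Γ' ++ .tick θ :: Γ) →
      HasType Δ (Γ' ++ .tick θ :: Γ) (.adv (.var (i + Γ'.nvars))) A
  | select {Γ Γ' : Ctx} {θ : Clk} {v₁ v₂ : Tm} {A₁ A₂ : Ty} :
      IsValue v₁ → IsValue v₂ →
      HasType Δ Γ v₁ (.delayE A₁) → HasType Δ Γ v₂ (.delayE A₂) →
      ClkEq θ (.join (.cl v₁) (.cl v₂)) → WfCtx Δ (Γ' ++ .tick θ :: Γ) →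
      HasType Δ (Γ' ++ .tick θ :: Γ)
        (.select (v₁.rename (· + Γ'.nvars)) (v₂.rename (· + Γ'.nvars)))
        (.sum (.sum (.prod A₁ (.delayE A₂)) (.prod (.delayE A₁) A₂)) (.prod A₁ A₂))
  | zero {Γ : Ctx} : HasType Δ Γ .zero .nat
  | suc {Γ : Ctx} {t : Tm} : HasType Δ Γ t .nat → HasType Δ Γ (.suc t) .nat
  | recN {Γ : Ctx} {s t u : Tm} {A : Ty} :
      HasType Δ Γ s A → HasType Δ (.var A :: .var .nat :: Γ) t A → HasType Δ Γ u .nat →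
      HasType Δ Γ (.recN s t u) A
  | fix {Γ : Ctx} {t : Tm} {A : Ty} :
      HasType Δ (.var (.delayA A) :: Γ.stab) t A →
      HasType Δ Γ (.fix (t.rename (liftRen Γ.stabRen))) A
  | box {Γ : Ctx} {t : Tm} {A : Ty} :
      HasType Δ Γ.stab t A → HasType Δ Γ (.box (t.rename Γ.stabRen)) (.box A)
  | unbox {Γ : Ctx} {t : Tm} {A : Ty} :
      HasType Δ Γ t (.box A) → HasType Δ Γ (.unbox t) A
  | out {Γ : Ctx} {t : Tm} {A : Ty} :
      HasType Δ Γ t (.fix A) → HasType Δ Γ (.out t) A.unfold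
  | into {Γ : Ctx} {t : Tm} {A : Ty} :
      HasType Δ Γ t A.unfold → HasType Δ Γ (.into t) (.fix A)

/-- `IsClock Δ Γ θ` is `Γ ⊢_Δ θ : Clock`. -/
inductive IsClock (Δ : InputCtx) : Ctx → Clk → Prop
  | cl {Γ : Ctx} {v : Tm} {A : Ty} :
      IsValue v → HasType Δ Γ v (.delayE A) → IsClock Δ Γ (.cl v)
  | join {Γ : Ctx} {θ θ' : Clk} :
      IsClock Δ Γ θ → IsClock Δ Γ θ' → IsClock Δ Γ (.join θ θ')

/-- Well-formed contexts; they contain at most one tick. -/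
inductive WfCtx (Δ : InputCtx) : Ctx → Prop
  | nil : WfCtx Δ []
  | var {Γ : Ctx} {A : Ty} : WfCtx Δ Γ → WfCtx Δ (.var A :: Γ)
  | tick {Γ : Ctx} {θ : Clk} :
      WfCtx Δ Γ → IsClock Δ Γ θ → Γ.TickFree → WfCtx Δ (.tick θ :: Γ)

end

/-- `t : Δ ⇒ Γout`: the closed term `t` is a reactive program. -/
def IsReactiveProgram (t : Tm) (Δ : InputCtx) (Γout : OutputCtx) : Prop :=
  HasType Δ [] t Γout.prodTy

/-! ### Heaps and stores -/

/-- Heaps: finite maps from locations to terms. -/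
@[ext]
structure Heap where
  get : Loc → Option Tm
  finite_dom : {l | get l ≠ none}.Finite

namespace Heap

def dom (η : Heap) : Set Loc := {l | η.get l ≠ none}

def empty : Heap where
  get _ := none
  finite_dom := by simp

/-- The heap `η, l ↦ t`. -/
def insert (η : Heap) (l : Loc) (t : Tm) : Heap where
  get := Function.update η.get l (some t)
  finite_dom := by
    refine (η.finite_dom.insert l).subset ?_
    intro l' h
    by_cases hl : l' = l
    · exact Or.inl hl
    · right
      simpa [Function.update_of_ne hl] using h

/-- The part of `η` at the locations whose clock contains `κ`. -/
def clockIn (κ : Chan) (η : Heap) : Heap where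
  get l := if κ ∈ l.clock then η.get l else none
  finite_dom := by
    refine η.finite_dom.subset ?_
    intro l h
    by_cases hl : κ ∈ l.clock
    · simpa [hl] using h
    · simp [hl] at h

/-- The part of `η` at the locations whose clock does not contain `κ`. -/
def clockNotIn (κ : Chan) (η : Heap) : Heap where
  get l := if κ ∈ l.clock then none else η.get l
  finite_dom := by
    refine η.finite_dom.subset ?_
    intro l h
    by_cases hl : κ ∈ l.clock
    · simp [hl] at h
    · simpa [hl] using h

end Heap

/-- Stores: a single (later) heap, or a now heap and a later heap together with the new value `v` of
the channel `κ` that has just been updated. -/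
inductive Store : Type
  | one (ηL : Heap)
  | two (ηN : Heap) (κ : Chan) (v : Tm) (ηL : Heap)

/-- The later heap. -/
def Store.later : Store → Heap
  | .one ηL => ηL
  | .two _ _ _ ηL => ηL

/-- The store `σ, l ↦ t`, which extends the later heap. -/
def Store.insert : Store → Loc → Tm → Store
  | .one ηL, l, t => .one (ηL.insert l t)
  | .two ηN κ v ηL, l, t => .two ηN κ v (ηL.insert l t)

/-- Allocation functions: `alloc Θ σ` is a location that has clock `Θ` and is not used in the later
heap of `σ`. -/
structure Allocator where
  alloc : Clock → Store → Loc
  clock_alloc : ∀ Θ σ, (alloc Θ σ).clock = Θ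
  alloc_fresh : ∀ Θ σ, alloc Θ σ ∉ σ.later.dom

theorem exists_fresh (Θ : Clock) (η : Heap) : ∃ n : ℕ, ((Θ, n) : Loc) ∉ η.dom := by
  by_contra h
  push Not at h
  have hinj : Function.Injective (fun n : ℕ => ((Θ, n) : Loc)) := by
    intro a b hab
    exact (Prod.mk.inj hab).2
  exact Set.infinite_range_of_injective hinj
    (η.finite_dom.subset (by rintro _ ⟨n, rfl⟩; exact h n))

/-- Allocation functions exist. -/
instance : Nonempty Allocator :=
  ⟨{ alloc := fun Θ σ => (Θ, (exists_fresh Θ σ.later).choose)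
     clock_alloc := fun _ _ => rfl
     alloc_fresh := fun Θ σ => (exists_fresh Θ σ.later).choose_spec }⟩

/-! ### Evaluation semantics -/

/-- Input buffers: partial maps from channels to terms. -/
abbrev Buffer := Chan → Option Tm

/-- The clock of a closed clock expression, which is undefined if some `cl v` occurs in it where `v`
is neither a location nor of the form `inp κ`. -/
def Clk.eval : Clk → Option Clock
  | .cl (.loc l) => some l.clock
  | .cl (.inp κ) => some {κ}
  | .cl _ => none
  | .join θ θ' => Option.map₂ (· ∪ ·) (Clk.eval θ) (Clk.eval θ')

/-- Big-step evaluation: with input buffer `ι`, the term `t` and the store `σ` evaluate to the value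
`v` and the store `τ`. -/
inductive Eval (𝒜 : Allocator) (ι : Buffer) : Tm → Store → Tm → Store → Prop
  | value {v : Tm} {σ : Store} : IsValue v → Eval 𝒜 ι v σ v σ
  | pair {t t' v v' : Tm} {σ σ' σ'' : Store} :
      Eval 𝒜 ι t σ v σ' → Eval 𝒜 ι t' σ' v' σ'' → Eval 𝒜 ι (.pair t t') σ (.pair v v') σ''
  | fst {t v₁ v₂ : Tm} {σ σ' : Store} :
      Eval 𝒜 ι t σ (.pair v₁ v₂) σ' → Eval 𝒜 ι (.fst t) σ v₁ σ'
  | snd {t v₁ v₂ : Tm} {σ σ' : Store} :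
      Eval 𝒜 ι t σ (.pair v₁ v₂) σ' → Eval 𝒜 ι (.snd t) σ v₂ σ'
  | inl {t v : Tm} {σ σ' : Store} :
      Eval 𝒜 ι t σ v σ' → Eval 𝒜 ι (.inl t) σ (.inl v) σ'
  | inr {t v : Tm} {σ σ' : Store} :
      Eval 𝒜 ι t σ v σ' → Eval 𝒜 ι (.inr t) σ (.inr v) σ'
  | caseInl {t t₁ t₂ v w : Tm} {σ σ' σ'' : Store} :
      Eval 𝒜 ι t σ (.inl v) σ' → Eval 𝒜 ι (t₁.inst v) σ' w σ'' →
      Eval 𝒜 ι (.case t t₁ t₂) σ w σ''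
  | caseInr {t t₁ t₂ v w : Tm} {σ σ' σ'' : Store} :
      Eval 𝒜 ι t σ (.inr v) σ' → Eval 𝒜 ι (t₂.inst v) σ' w σ'' →
      Eval 𝒜 ι (.case t t₁ t₂) σ w σ''
  | app {t t' s v v' : Tm} {σ σ' σ'' σ''' : Store} :
      Eval 𝒜 ι t σ (.lam s) σ' → Eval 𝒜 ι t' σ' v σ'' → Eval 𝒜 ι (s.inst v) σ'' v' σ''' →
      Eval 𝒜 ι (.app t t') σ v' σ'''
  | letin {s t v w : Tm} {σ σ' σ'' : Store} :
      Eval 𝒜 ι s σ v σ' → Eval 𝒜 ι (t.inst v) σ' w σ'' → Eval 𝒜 ι (.letin s t) σ w σ''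
  | buf {κ : Chan} {v : Tm} {σ : Store} : ι κ = some v → Eval 𝒜 ι (.buf κ) σ v σ
  | delay {θ : Clk} {Θ : Clock} {t : Tm} {σ : Store} :
      θ.eval = some Θ →
      Eval 𝒜 ι (.delay θ t) σ (.loc (𝒜.alloc Θ σ)) (σ.insert (𝒜.alloc Θ σ) t)
  | never {σ : Store} : Eval 𝒜 ι .never σ (.loc (𝒜.alloc ∅ σ)) σ
  | advInp {ηN ηL : Heap} {κ : Chan} {v : Tm} :
      Eval 𝒜 ι (.adv (.inp κ)) (.two ηN κ v ηL) v (.two ηN κ v ηL)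
  | advLoc {ηN ηL : Heap} {κ : Chan} {v : Tm} {l : Loc} {t w : Tm} {σ : Store} :
      ηN.get l = some t → Eval 𝒜 ι t (.two ηN κ v ηL) w σ →
      Eval 𝒜 ι (.adv (.loc l)) (.two ηN κ v ηL) w σ
  | selectLeft {ηN ηL : Heap} {κ : Chan} {w v₁ v₂ u₁ : Tm} {Θ₁ Θ₂ : Clock} {σ : Store} :
      (Clk.cl v₁).eval = some Θ₁ → (Clk.cl v₂).eval = some Θ₂ → κ ∈ Θ₁ → κ ∉ Θ₂ →
      Eval 𝒜 ι (.adv v₁) (.two ηN κ w ηL) u₁ σ →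
      Eval 𝒜 ι (.select v₁ v₂) (.two ηN κ w ηL) (.inl (.inl (.pair u₁ v₂))) σ
  | selectRight {ηN ηL : Heap} {κ : Chan} {w v₁ v₂ u₂ : Tm} {Θ₁ Θ₂ : Clock} {σ : Store} :
      (Clk.cl v₁).eval = some Θ₁ → (Clk.cl v₂).eval = some Θ₂ → κ ∉ Θ₁ → κ ∈ Θ₂ →
      Eval 𝒜 ι (.adv v₂) (.two ηN κ w ηL) u₂ σ →
      Eval 𝒜 ι (.select v₁ v₂) (.two ηN κ w ηL) (.inl (.inr (.pair v₁ u₂))) σ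
  | selectBoth {ηN ηL : Heap} {κ : Chan} {w v₁ v₂ u₁ u₂ : Tm} {Θ₁ Θ₂ : Clock}
      {σ σ' : Store} :
      (Clk.cl v₁).eval = some Θ₁ → (Clk.cl v₂).eval = some Θ₂ → κ ∈ Θ₁ → κ ∈ Θ₂ →
      Eval 𝒜 ι (.adv v₁) (.two ηN κ w ηL) u₁ σ → Eval 𝒜 ι (.adv v₂) σ u₂ σ' →
      Eval 𝒜 ι (.select v₁ v₂) (.two ηN κ w ηL) (.inr (.pair u₁ u₂)) σ'
  | suc {t v : Tm} {σ σ' : Store} :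
      Eval 𝒜 ι t σ v σ' → Eval 𝒜 ι (.suc t) σ (.suc v) σ'
  | recZero {s t u v : Tm} {σ σ' σ'' : Store} :
      Eval 𝒜 ι u σ .zero σ' → Eval 𝒜 ι s σ' v σ'' → Eval 𝒜 ι (.recN s t u) σ v σ''
  | recSuc {s t u v v' w : Tm} {σ σ' σ'' σ''' : Store} :
      Eval 𝒜 ι u σ (.suc v) σ' → Eval 𝒜 ι (.recN s t v) σ' v' σ'' →
      Eval 𝒜 ι (t.inst₂ v v') σ'' w σ''' → Eval 𝒜 ι (.recN s t u) σ w σ'''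
  | advDfix {t v : Tm} {σ σ' : Store} :
      Eval 𝒜 ι (t.inst (.dfix t)) σ v σ' → Eval 𝒜 ι (.adv (.dfix t)) σ v σ'
  | fix {t v : Tm} {σ σ' : Store} :
      Eval 𝒜 ι (t.inst (.dfix t)) σ v σ' → Eval 𝒜 ι (.fix t) σ v σ'
  | unbox {t t' v : Tm} {σ σ' σ'' : Store} :
      Eval 𝒜 ι t σ (.box t') σ' → Eval 𝒜 ι t' σ' v σ'' → Eval 𝒜 ι (.unbox t) σ v σ''
  | into {t v : Tm} {σ σ' : Store} :
      Eval 𝒜 ι t σ v σ' → Eval 𝒜 ι (.into t) σ (.into v) σ'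
  | out {t v : Tm} {σ σ' : Store} :
      Eval 𝒜 ι t σ (.into v) σ' → Eval 𝒜 ι (.out t) σ v σ'

/-! ### Reactive semantics -/

/-- Sequences `x₁ ↦ v₁, …, xₙ ↦ vₙ` of output values. -/
abbrev Outputs := List (OutChan × Tm)

/-- Sequences `x₁ ↦ l₁, …, xₙ ↦ lₙ` of output channels with the locations of their next values. -/
abbrev Pending := List (OutChan × Loc)

/-- States of the machine: `⟨t; ι⟩` and `⟨N; σ; ι⟩`. -/
inductive State : Type
  | start (t : Tm) (ι : Buffer)
  | run (N : Pending) (σ : Store) (ι : Buffer)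

/-- Transition labels: `κ ↦ v` for input transitions, and output values for the initialisation
transition and for output transitions. -/
inductive Label : Type
  | input (κ : Chan) (v : Tm)
  | output (O : Outputs)

/-- `ι[κ ↦ v]` if `κ ∈ dom ι`, and `ι` otherwise. -/
def Buffer.refresh (ι : Buffer) (κ : Chan) (v : Tm) : Buffer :=
  if (ι κ).isSome then Function.update ι κ (some v) else ι

/-- The transitions of the machine for the output context `Γout`. -/
inductive Step (𝒜 : Allocator) (Γout : OutputCtx) : State → Label → State → Prop
  | init {t : Tm} {ι : Buffer} {η : Heap} (r : List (OutChan × Tm × Loc)) :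
      r.map (fun e => e.1) = Γout.decls.map (fun d => d.1) →
      Eval 𝒜 ι t (.one .empty)
        (Tm.tuple (r.map fun e => Tm.cons e.2.1 (.loc e.2.2))) (.one η) →
      Step 𝒜 Γout (.start t ι) (.output (r.map fun e => (e.1, e.2.1)))
        (.run (r.map fun e => (e.1, e.2.2)) (.one η) ι)
  | input {N : Pending} {η : Heap} {ι : Buffer} {κ : Chan} {v : Tm} :
      Step 𝒜 Γout (.run N (.one η) ι) (.input κ v)
        (.run N (.two (η.clockIn κ) κ v (η.clockNotIn κ)) (ι.refresh κ v))
  | outputEnd {ηN ηL : Heap} {ι : Buffer} {κ : Chan} {v : Tm} :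
      Step 𝒜 Γout (.run [] (.two ηN κ v ηL) ι) (.output []) (.run [] (.one ηL) ι)
  | outputSkip {x : OutChan} {l : Loc} {N N' : Pending} {ηN ηL η : Heap} {ι : Buffer}
      {κ : Chan} {v : Tm} {O : Outputs} :
      κ ∉ l.clock →
      Step 𝒜 Γout (.run N (.two ηN κ v ηL) ι) (.output O) (.run N' (.one η) ι) →
      Step 𝒜 Γout (.run ((x, l) :: N) (.two ηN κ v ηL) ι) (.output O)
        (.run ((x, l) :: N') (.one η) ι)
  | outputCompute {x : OutChan} {l l' : Loc} {N N' : Pending} {ηN ηL η : Heap} {ι : Buffer}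
      {κ : Chan} {v v' : Tm} {σ : Store} {O : Outputs} :
      κ ∈ l.clock →
      Eval 𝒜 ι (.adv (.loc l)) (.two ηN κ v ηL) (Tm.cons v' (.loc l')) σ →
      Step 𝒜 Γout (.run N σ ι) (.output O) (.run N' (.one η) ι) →
      Step 𝒜 Γout (.run ((x, l) :: N) (.two ηN κ v ηL) ι) (.output ((x, v') :: O))
        (.run ((x, l') :: N') (.one η) ι)

/-! ### Well-typed inputs and outputs -/

/-- `v` is a value with `⊢ v : A`, without input channels and variables. -/
def ValueOfType (v : Tm) (A : Ty) : Prop := IsValue v ∧ HasType .empty [] v A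

/-- `⊢ ι : Δ`. -/
def BufferTyped (Δ : InputCtx) (ι : Buffer) : Prop :=
  ∀ κ c A, Δ.Has κ c A → c.IsBuffered → ∃ v, ι κ = some v ∧ ValueOfType v A

/-- `⊢ κ ↦ v : Δ`. -/
def InputTyped (Δ : InputCtx) (κ : Chan) (v : Tm) : Prop :=
  ∃ c A, Δ.Has κ c A ∧ ValueOfType v A

/-- `⊢ O : Γout`. -/
def OutputsTyped (Γout : OutputCtx) (O : Outputs) : Prop :=
  ∀ x v, (x, v) ∈ O → ∃ A, (x, A) ∈ Γout.decls ∧ ValueOfType v A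

end AsyncRaTT

open AsyncRaTT

/-!
# Productivity of Async RaTT

Well-typed terms are related to a step-indexed Kripke logical relation. `ValRel 𝒜 Δ n A η v` says
that `v` behaves as a value of type `A` over the later heap `η` during the next `n` inputs, and
`ExpRel` says that a term evaluates to such a value while the later heap only grows. The relation is
defined by recursion on `n` and, for equal `n`, on the size of the type: unfolding a recursive type
puts its recursive occurrences under a delay, and the body of a delay is only consulted after the
next input. A delayed value over `η` is one that can be advanced in the store obtained from any
extension of `η` by an input on its clock, and that remains a delayed value after any other input.
This is why deleting the part of the heap whose clock has ticked does no harm.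

The fundamental property, `HasType.expRel`, goes by induction on typing derivations. Its main point
is `delay`. A term stored at a location may wait for several inputs, during which most values
captured in it become invalid. However, to the right of a tick only the variables of stable type and
the delayed variables in the clock of the tick are used semantically (`TickEnvRel`). The former do
not depend on the heap (`ValRel.of_stable`), and the latter survive until the clock of the location
ticks, since it contains their clocks (`valRel_loc`). For `fix`, the delayed fixed point is shown to
be good by induction on the number of remaining inputs.

Evaluation is deterministic (`Eval.deterministic`), so the values obtained for the various `n`
coincide and are good for all `n` at once (`LimitRel`). A good value of type `Sig A` is a value of
type `A` together with a location, as input channels carry value types only; hence each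
initialisation and output step exists, has well-typed outputs, and leads to pending locations that
are good again (`exists_init_step`, `exists_output_step`). Iterating gives the infinite run.
-/

namespace AsyncRaTT

/-! ### Substitution -/

theorem liftRen_comp (ρ ρ' : ℕ → ℕ) : liftRen ρ' ∘ liftRen ρ = liftRen (ρ' ∘ ρ) := by
  funext i; cases i <;> rfl

theorem up_comp_liftRen (s : ℕ → Tm) (ρ : ℕ → ℕ) : up s ∘ liftRen ρ = up (s ∘ ρ) := by
  funext i; cases i <;> rfl

theorem Tm.rename_rename (t : Tm) (ρ ρ' : ℕ → ℕ) :
    (t.rename ρ).rename ρ' = t.rename (ρ' ∘ ρ) := by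
  induction t using Tm.rec
    (motive_2 := fun θ => ∀ ρ ρ' : ℕ → ℕ, (θ.rename ρ).rename ρ' = θ.rename (ρ' ∘ ρ))
    generalizing ρ ρ' with
  | _ => simp_all [Tm.rename, Clk.rename, liftRen_comp]

theorem Tm.subst_of_rename (t : Tm) (ρ : ℕ → ℕ) (s : ℕ → Tm) :
    (t.rename ρ).subst s = t.subst (s ∘ ρ) := by
  induction t using Tm.rec
    (motive_2 := fun θ => ∀ (ρ : ℕ → ℕ) (s : ℕ → Tm), (θ.rename ρ).subst s = θ.subst (s ∘ ρ))
    generalizing ρ s with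
  | _ => simp_all [Tm.rename, Tm.subst, Clk.rename, Clk.subst, up_comp_liftRen]

theorem rename_up (ρ : ℕ → ℕ) (s : ℕ → Tm) :
    (fun i => (up s i).rename (liftRen ρ)) = up fun i => (s i).rename ρ := by
  funext i
  cases i with
  | zero => rfl
  | succ i =>
    simp only [up, scons, Tm.rename_rename]
    rfl

theorem Tm.rename_of_subst (t : Tm) (ρ : ℕ → ℕ) (s : ℕ → Tm) :
    (t.subst s).rename ρ = t.subst fun i => (s i).rename ρ := by
  induction t using Tm.rec
    (motive_2 := fun θ => ∀ (ρ : ℕ → ℕ) (s : ℕ → Tm),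
      (θ.subst s).rename ρ = θ.subst fun i => (s i).rename ρ)
    generalizing ρ s with
  | _ => simp_all [Tm.rename, Tm.subst, Clk.rename, Clk.subst, rename_up]

theorem subst_up (s s' : ℕ → Tm) :
    (fun i => (up s i).subst (up s')) = up fun i => (s i).subst s' := by
  funext i
  cases i with
  | zero => rfl
  | succ i =>
    simp only [up, scons, Tm.subst_of_rename, Tm.rename_of_subst]
    rfl

theorem Tm.subst_subst (t : Tm) (s s' : ℕ → Tm) :
    (t.subst s).subst s' = t.subst fun i => (s i).subst s' := by
  induction t using Tm.rec
    (motive_2 := fun θ => ∀ s s' : ℕ → Tm, (θ.subst s).subst s' = θ.subst fun i => (s i).subst s')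
    generalizing s s' with
  | _ => simp_all [Tm.subst, Clk.subst, subst_up]

theorem up_var : up Tm.var = Tm.var := by
  funext i; cases i <;> rfl

theorem Tm.subst_var (t : Tm) : t.subst .var = t := by
  induction t using Tm.rec (motive_2 := fun θ => θ.subst .var = θ) with
  | _ => simp_all [Tm.subst, Clk.subst, up_var]

theorem Tm.subst_up_inst (t v : Tm) (s : ℕ → Tm) :
    (t.subst (up s)).inst v = t.subst (scons v s) := by
  rw [Tm.inst, Tm.subst_subst]
  congr 1
  funext i
  cases i with
  | zero => rfl
  | succ i =>
    simp only [up, scons, Tm.subst_of_rename]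
    exact Tm.subst_var (s i)

theorem Tm.subst_up_up_inst₂ (t v w : Tm) (s : ℕ → Tm) :
    (t.subst (up (up s))).inst₂ v w = t.subst (scons w (scons v s)) := by
  rw [Tm.inst₂, Tm.subst_subst]
  congr 1
  funext i
  rcases i with _ | _ | i
  · rfl
  · rfl
  · simp only [up, scons, Tm.subst_of_rename]
    exact Tm.subst_var (s i)

/-! ### Determinism of evaluation -/

section Determinism

variable {𝒜 : Allocator} {ι : Buffer}

theorem Eval.eq_of_isValue {t v : Tm} {σ τ : Store} (h : Eval 𝒜 ι t σ v τ) (ht : IsValue t) :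
    t = v ∧ σ = τ := by
  induction h with
  | value => exact ⟨rfl, rfl⟩
  | pair _ _ ih₁ ih₂ =>
    cases ht with
    | pair h₁ h₂ =>
      obtain ⟨rfl, rfl⟩ := ih₁ h₁
      obtain ⟨rfl, rfl⟩ := ih₂ h₂
      exact ⟨rfl, rfl⟩
  | inl _ ih => cases ht with | inl h => obtain ⟨rfl, rfl⟩ := ih h; exact ⟨rfl, rfl⟩
  | inr _ ih => cases ht with | inr h => obtain ⟨rfl, rfl⟩ := ih h; exact ⟨rfl, rfl⟩
  | suc _ ih => cases ht with | suc h => obtain ⟨rfl, rfl⟩ := ih h; exact ⟨rfl, rfl⟩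
  | into _ ih => cases ht with | into h => obtain ⟨rfl, rfl⟩ := ih h; exact ⟨rfl, rfl⟩
  | _ => cases ht

theorem Eval.deterministic {t v v' : Tm} {σ τ τ' : Store} (h : Eval 𝒜 ι t σ v τ)
    (h' : Eval 𝒜 ι t σ v' τ') : v = v' ∧ τ = τ' := by
  induction h generalizing v' τ' with
  | value hv => exact h'.eq_of_isValue hv
  | pair h₁ h₂ ih₁ ih₂ =>
    cases h' with
    | value hv =>
      obtain ⟨h, h'⟩ := (Eval.pair h₁ h₂).eq_of_isValue hv
      exact ⟨h.symm, h'.symm⟩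
    | pair h₁' h₂' =>
      obtain ⟨rfl, rfl⟩ := ih₁ h₁'
      obtain ⟨rfl, rfl⟩ := ih₂ h₂'
      exact ⟨rfl, rfl⟩
  | inl h ih =>
    cases h' with
    | value hv =>
      obtain ⟨h, h'⟩ := (Eval.inl h).eq_of_isValue hv
      exact ⟨h.symm, h'.symm⟩
    | inl h' => obtain ⟨rfl, rfl⟩ := ih h'; exact ⟨rfl, rfl⟩
  | inr h ih =>
    cases h' with
    | value hv =>
      obtain ⟨h, h'⟩ := (Eval.inr h).eq_of_isValue hv
      exact ⟨h.symm, h'.symm⟩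
    | inr h' => obtain ⟨rfl, rfl⟩ := ih h'; exact ⟨rfl, rfl⟩
  | suc h ih =>
    cases h' with
    | value hv =>
      obtain ⟨h, h'⟩ := (Eval.suc h).eq_of_isValue hv
      exact ⟨h.symm, h'.symm⟩
    | suc h' => obtain ⟨rfl, rfl⟩ := ih h'; exact ⟨rfl, rfl⟩
  | into h ih =>
    cases h' with
    | value hv =>
      obtain ⟨h, h'⟩ := (Eval.into h).eq_of_isValue hv
      exact ⟨h.symm, h'.symm⟩
    | into h' => obtain ⟨rfl, rfl⟩ := ih h'; exact ⟨rfl, rfl⟩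
  | fst _ ih =>
    cases h' with
    | value hv => cases hv
    | fst h' => obtain ⟨h, rfl⟩ := ih h'; cases h; exact ⟨rfl, rfl⟩
  | snd _ ih =>
    cases h' with
    | value hv => cases hv
    | snd h' => obtain ⟨h, rfl⟩ := ih h'; cases h; exact ⟨rfl, rfl⟩
  | caseInl _ _ ih₁ ih₂ =>
    cases h' with
    | value hv => cases hv
    | caseInl h₁' h₂' => obtain ⟨h, rfl⟩ := ih₁ h₁'; cases h; exact ih₂ h₂'
    | caseInr h₁' h₂' => obtain ⟨h, rfl⟩ := ih₁ h₁'; cases h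
  | caseInr _ _ ih₁ ih₂ =>
    cases h' with
    | value hv => cases hv
    | caseInl h₁' h₂' => obtain ⟨h, rfl⟩ := ih₁ h₁'; cases h
    | caseInr h₁' h₂' => obtain ⟨h, rfl⟩ := ih₁ h₁'; cases h; exact ih₂ h₂'
  | app _ _ _ ih₁ ih₂ ih₃ =>
    cases h' with
    | value hv => cases hv
    | app h₁' h₂' h₃' =>
      obtain ⟨h, rfl⟩ := ih₁ h₁'
      cases h
      obtain ⟨rfl, rfl⟩ := ih₂ h₂'
      exact ih₃ h₃'
  | letin _ _ ih₁ ih₂ =>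
    cases h' with
    | value hv => cases hv
    | letin h₁' h₂' => obtain ⟨rfl, rfl⟩ := ih₁ h₁'; exact ih₂ h₂'
  | buf hv =>
    cases h' with
    | value hv => cases hv
    | buf hv' => rw [hv] at hv'; cases hv'; exact ⟨rfl, rfl⟩
  | delay hΘ =>
    cases h' with
    | value hv => cases hv
    | delay hΘ' => rw [hΘ] at hΘ'; cases hΘ'; exact ⟨rfl, rfl⟩
  | never =>
    cases h' with
    | value hv => cases hv
    | never => exact ⟨rfl, rfl⟩
  | advInp =>
    cases h' with
    | value hv => cases hv
    | advInp => exact ⟨rfl, rfl⟩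
  | advLoc hl _ ih =>
    cases h' with
    | value hv => cases hv
    | advLoc hl' h' => rw [hl] at hl'; cases hl'; exact ih h'
  | selectLeft h₁ h₂ hm₁ hm₂ _ ih =>
    cases h' with
    | value hv => cases hv
    | selectLeft _ _ _ _ h' => obtain ⟨rfl, rfl⟩ := ih h'; exact ⟨rfl, rfl⟩
    | selectRight h₁' _ hm₁' => rw [h₁] at h₁'; cases h₁'; exact absurd hm₁ hm₁'
    | selectBoth _ h₂' _ hm₂' => rw [h₂] at h₂'; cases h₂'; exact absurd hm₂' hm₂
  | selectRight h₁ h₂ hm₁ hm₂ _ ih =>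
    cases h' with
    | value hv => cases hv
    | selectLeft h₁' _ hm₁' => rw [h₁] at h₁'; cases h₁'; exact absurd hm₁' hm₁
    | selectRight _ _ _ _ h' => obtain ⟨rfl, rfl⟩ := ih h'; exact ⟨rfl, rfl⟩
    | selectBoth h₁' _ hm₁' => rw [h₁] at h₁'; cases h₁'; exact absurd hm₁' hm₁
  | selectBoth h₁ h₂ hm₁ hm₂ _ _ ih₁ ih₂ =>
    cases h' with
    | value hv => cases hv
    | selectLeft _ h₂' _ hm₂' => rw [h₂] at h₂'; cases h₂'; exact absurd hm₂ hm₂'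
    | selectRight h₁' _ hm₁' => rw [h₁] at h₁'; cases h₁'; exact absurd hm₁ hm₁'
    | selectBoth _ _ _ _ h₁' h₂' =>
      obtain ⟨rfl, rfl⟩ := ih₁ h₁'
      obtain ⟨rfl, rfl⟩ := ih₂ h₂'
      exact ⟨rfl, rfl⟩
  | recZero _ _ ih₁ ih₂ =>
    cases h' with
    | value hv => cases hv
    | recZero h₁' h₂' => obtain ⟨_, rfl⟩ := ih₁ h₁'; exact ih₂ h₂'
    | recSuc h₁' => obtain ⟨h, _⟩ := ih₁ h₁'; cases h
  | recSuc _ _ _ ih₁ ih₂ ih₃ =>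
    cases h' with
    | value hv => cases hv
    | recZero h₁' => obtain ⟨h, _⟩ := ih₁ h₁'; cases h
    | recSuc h₁' h₂' h₃' =>
      obtain ⟨h, rfl⟩ := ih₁ h₁'
      cases h
      obtain ⟨rfl, rfl⟩ := ih₂ h₂'
      exact ih₃ h₃'
  | advDfix _ ih =>
    cases h' with
    | value hv => cases hv
    | advDfix h' => exact ih h'
  | fix _ ih =>
    cases h' with
    | value hv => cases hv
    | fix h' => exact ih h'
  | unbox _ _ ih₁ ih₂ =>
    cases h' with
    | value hv => cases hv
    | unbox h₁' h₂' => obtain ⟨h, rfl⟩ := ih₁ h₁'; cases h; exact ih₂ h₂'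
  | out _ ih =>
    cases h' with
    | value hv => cases hv
    | out h' => obtain ⟨h, rfl⟩ := ih h'; cases h; exact ⟨rfl, rfl⟩

end Determinism
/-! ### Extension of heaps and stores -/

/-- `η ≤ η'` if `η'` extends `η`. -/
instance : Preorder Heap where
  le η η' := ∀ l t, η.get l = some t → η'.get l = some t
  le_refl _ _ _ h := h
  le_trans _ _ _ h h' l t ht := h' l t (h l t ht)

theorem Heap.le_insert {η : Heap} {l : Loc} (t : Tm) (h : l ∉ η.dom) : η ≤ η.insert l t := by
  intro l' t' ht'
  have hne : l' ≠ l := by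
    rintro rfl
    exact h (by simp [Heap.dom, ht'])
  simpa [Heap.insert, Function.update_of_ne hne] using ht'

theorem Heap.insert_get (η : Heap) (l : Loc) (t : Tm) : (η.insert l t).get l = some t := by
  simp [Heap.insert]

/-- The extension order on stores: only the later heap may grow. Allocation may reuse a location of
the now heap, which is harmless because values are interpreted over the later heap alone. -/
inductive Store.Extends : Store → Store → Prop
  | one {η η' : Heap} : η ≤ η' → Extends (.one η) (.one η')
  | two {ηN ηL ηL' : Heap} {κ : Chan} {v : Tm} :
      ηL ≤ ηL' → Extends (.two ηN κ v ηL) (.two ηN κ v ηL')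

instance : Preorder Store where
  le := Store.Extends
  le_refl
    | .one _ => .one le_rfl
    | .two _ _ _ _ => .two le_rfl
  le_trans
    | _, _, _, .one h, .one h' => .one (h.trans h')
    | _, _, _, .two h, .two h' => .two (h.trans h')

theorem Store.later_mono {σ τ : Store} (h : σ ≤ τ) : σ.later ≤ τ.later := by
  cases h with
  | one h => exact h
  | two h => exact h

theorem Store.le_insert {σ : Store} {l : Loc} (t : Tm) (h : l ∉ σ.later.dom) :
    σ ≤ σ.insert l t := by
  cases σ with
  | one η => exact .one (Heap.le_insert t h)
  | two ηN κ v ηL => exact .two (Heap.le_insert t h)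

theorem Store.insert_later_get (σ : Store) (l : Loc) (t : Tm) :
    (σ.insert l t).later.get l = some t := by
  cases σ <;> exact Heap.insert_get _ _ _

/-! ### The logical relation -/

/-- The size of a type, where the body of a delay does not count. Unfolding a recursive type
makes it smaller, because the recursive occurrences are delayed. -/
def Ty.size : Ty → ℕ
  | tvar _ => 0
  | unit => 0
  | nat => 0
  | prod A B => A.size + B.size + 1
  | sum A B => A.size + B.size + 1
  | arr A B => A.size + B.size + 1
  | delayE _ => 0
  | delayA _ => 0
  | fix A => A.size + 1
  | box A => A.size + 1

theorem Ty.size_rename (A : Ty) (ρ : ℕ → ℕ) : (A.rename ρ).size = A.size := by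
  induction A generalizing ρ <;> simp_all [Ty.rename, Ty.size]

theorem Ty.size_subst (A : Ty) (s : ℕ → Ty) (hs : ∀ i, (s i).size = 0) :
    (A.subst s).size = A.size := by
  induction A generalizing s with
  | fix A ih =>
    simp only [Ty.subst, Ty.size]
    rw [ih]
    rintro (_ | i)
    · rfl
    · simpa [Ty.up, Ty.size_rename] using hs i
  | _ => simp_all [Ty.subst, Ty.size]

theorem Ty.size_unfold (A : Ty) : A.unfold.size = A.size := by
  refine A.size_subst _ ?_
  rintro (_ | i) <;> rfl

/-- Induction on types in which a recursive type is reached from its unfolding. -/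
@[elab_as_elim]
theorem Ty.unfold_induction {P : Ty → Prop} (tvar : ∀ i, P (.tvar i)) (unit : P .unit)
    (nat : P .nat) (prod : ∀ A B, P A → P B → P (.prod A B))
    (sum : ∀ A B, P A → P B → P (.sum A B)) (arr : ∀ A B, P A → P B → P (.arr A B))
    (delayE : ∀ A, P (.delayE A)) (delayA : ∀ A, P (.delayA A))
    (fix : ∀ A, P A.unfold → P (.fix A)) (box : ∀ A, P A → P (.box A)) (A : Ty) : P A := by
  induction hk : A.size using Nat.strong_induction_on generalizing A with
  | _ k ih =>
    subst hk
    cases A with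
    | tvar i => exact tvar i
    | unit => exact unit
    | nat => exact nat
    | prod A B =>
      exact prod A B (ih _ (by simp only [Ty.size]; omega) A rfl)
        (ih _ (by simp only [Ty.size]; omega) B rfl)
    | sum A B =>
      exact sum A B (ih _ (by simp only [Ty.size]; omega) A rfl)
        (ih _ (by simp only [Ty.size]; omega) B rfl)
    | arr A B =>
      exact arr A B (ih _ (by simp only [Ty.size]; omega) A rfl)
        (ih _ (by simp only [Ty.size]; omega) B rfl)
    | delayE A => exact delayE A
    | delayA A => exact delayA A
    | fix A => exact fix A (ih _ (by rw [Ty.size_unfold]; exact Nat.lt_succ_self _) _ rfl)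
    | box A => exact box A (ih _ (Nat.lt_succ_self _) A rfl)

/-- The numerals, which are the closed values of type `nat`. -/
inductive IsNumeral : Tm → Prop
  | zero : IsNumeral .zero
  | suc {v : Tm} : IsNumeral v → IsNumeral (.suc v)

/-- The closed values that may inhabit `delayE A`: locations and input channels of type `A`. -/
def IsDelayed (Δ : InputCtx) (A : Ty) (v : Tm) : Prop :=
  (∃ l, v = .loc l) ∨ ∃ κ c, v = .inp κ ∧ Δ.Has κ c A

/-- The expression relation for a family `P` of semantic values: with any well-typed input buffer,
`t` evaluates to a value in `P`, and evaluation only extends the later heap of the store. -/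
def ExpRel (𝒜 : Allocator) (Δ : InputCtx) (P : Heap → Tm → Prop) (σ : Store) (t : Tm) : Prop :=
  ∀ ι, BufferTyped Δ ι → ∃ v τ, Eval 𝒜 ι t σ v τ ∧ σ ≤ τ ∧ P τ.later v

/-- The value relation: `ValRel 𝒜 Δ n A η v` says that `v` behaves as a value of type `A` over the
later heap `η` for the next `n` inputs. Type variables are interpreted by the empty type.

For `delayE A`, the next input and all extensions of the heap before and after that input are
considered. If the input is on the clock of `v`, then `v` can be advanced in the resulting store;
otherwise `v` remains a good value over the heap that has survived the input. -/
def ValRel (𝒜 : Allocator) (Δ : InputCtx) (n : ℕ) : Ty → Heap → Tm → Prop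
  | .tvar _ => fun _ _ => False
  | .unit => fun _ v => v = .unit
  | .nat => fun _ v => IsNumeral v
  | .prod A B => fun η v =>
      ∃ v₁ v₂, v = .pair v₁ v₂ ∧ ValRel 𝒜 Δ n A η v₁ ∧ ValRel 𝒜 Δ n B η v₂
  | .sum A B => fun η v =>
      (∃ u, v = .inl u ∧ ValRel 𝒜 Δ n A η u) ∨ ∃ u, v = .inr u ∧ ValRel 𝒜 Δ n B η u
  | .arr A B => fun η v =>
      ∃ t, v = .lam t ∧ ∀ (σ : Store) (u : Tm), η ≤ σ.later → ValRel 𝒜 Δ n A σ.later u →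
        ExpRel 𝒜 Δ (ValRel 𝒜 Δ n B) σ (t.inst u)
  | .delayE A => fun η v =>
      IsDelayed Δ A v ∧ ∀ m, m + 1 = n → ∀ Θ, (Clk.cl v).eval = some Θ →
        ∀ κ w, InputTyped Δ κ w → ∀ η' ≥ η, ∀ ηL ≥ η'.clockNotIn κ,
          (κ ∈ Θ → ExpRel 𝒜 Δ (ValRel 𝒜 Δ m A) (.two (η'.clockIn κ) κ w ηL) (.adv v)) ∧
          (κ ∉ Θ → ValRel 𝒜 Δ m (.delayE A) ηL v)
  | .delayA A => fun _ v =>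
      ∃ t, v = .dfix t ∧ ∀ m, m < n → ∀ σ, ExpRel 𝒜 Δ (ValRel 𝒜 Δ m A) σ (t.inst (.dfix t))
  | .fix A => fun η v => ∃ u, v = .into u ∧ ValRel 𝒜 Δ n A.unfold η u
  | .box A => fun _ v =>
      ∃ t, v = .box t ∧ ∀ m, m ≤ n → ∀ σ, ExpRel 𝒜 Δ (ValRel 𝒜 Δ m A) σ t
termination_by A => (n, A.size)
decreasing_by
  all_goals simp only [Prod.lex_def, Ty.size, Ty.size_unfold, true_and]
  all_goals omega

section Relation

variable {𝒜 : Allocator} {Δ : InputCtx} {n m : ℕ} {A B : Ty} {η η' : Heap} {v : Tm}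

theorem valRel_tvar {i : ℕ} : ValRel 𝒜 Δ n (.tvar i) η v ↔ False := by
  rw [ValRel]

theorem valRel_unit : ValRel 𝒜 Δ n .unit η v ↔ v = .unit := by
  rw [ValRel]

theorem valRel_nat : ValRel 𝒜 Δ n .nat η v ↔ IsNumeral v := by
  rw [ValRel]

theorem valRel_prod : ValRel 𝒜 Δ n (.prod A B) η v ↔
    ∃ v₁ v₂, v = .pair v₁ v₂ ∧ ValRel 𝒜 Δ n A η v₁ ∧ ValRel 𝒜 Δ n B η v₂ := by
  rw [ValRel]

theorem valRel_sum : ValRel 𝒜 Δ n (.sum A B) η v ↔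
    (∃ u, v = .inl u ∧ ValRel 𝒜 Δ n A η u) ∨ ∃ u, v = .inr u ∧ ValRel 𝒜 Δ n B η u := by
  rw [ValRel]

theorem valRel_arr : ValRel 𝒜 Δ n (.arr A B) η v ↔
    ∃ t, v = .lam t ∧ ∀ (σ : Store) (u : Tm), η ≤ σ.later → ValRel 𝒜 Δ n A σ.later u →
      ExpRel 𝒜 Δ (ValRel 𝒜 Δ n B) σ (t.inst u) := by
  rw [ValRel]

theorem valRel_delayE : ValRel 𝒜 Δ n (.delayE A) η v ↔
    IsDelayed Δ A v ∧ ∀ m, m + 1 = n → ∀ Θ, (Clk.cl v).eval = some Θ →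
      ∀ κ w, InputTyped Δ κ w → ∀ η' ≥ η, ∀ ηL ≥ η'.clockNotIn κ,
        (κ ∈ Θ → ExpRel 𝒜 Δ (ValRel 𝒜 Δ m A) (.two (η'.clockIn κ) κ w ηL) (.adv v)) ∧
        (κ ∉ Θ → ValRel 𝒜 Δ m (.delayE A) ηL v) := by
  rw [ValRel]

theorem valRel_delayA : ValRel 𝒜 Δ n (.delayA A) η v ↔
    ∃ t, v = .dfix t ∧ ∀ m, m < n → ∀ σ,
      ExpRel 𝒜 Δ (ValRel 𝒜 Δ m A) σ (t.inst (.dfix t)) := by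
  rw [ValRel]

theorem valRel_fix : ValRel 𝒜 Δ n (.fix A) η v ↔
    ∃ u, v = .into u ∧ ValRel 𝒜 Δ n A.unfold η u := by
  rw [ValRel]

theorem valRel_box : ValRel 𝒜 Δ n (.box A) η v ↔
    ∃ t, v = .box t ∧ ∀ m, m ≤ n → ∀ σ, ExpRel 𝒜 Δ (ValRel 𝒜 Δ m A) σ t := by
  rw [ValRel]

theorem IsNumeral.isValue (h : IsNumeral v) : IsValue v := by
  induction h with
  | zero => exact .zero
  | suc _ ih => exact .suc ih

theorem IsDelayed.isValue (h : IsDelayed Δ A v) : IsValue v := by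
  rcases h with ⟨l, rfl⟩ | ⟨κ, c, rfl, _⟩
  exacts [.loc, .inp]

theorem IsDelayed.exists_eval (h : IsDelayed Δ A v) : ∃ Θ, (Clk.cl v).eval = some Θ := by
  rcases h with ⟨l, rfl⟩ | ⟨κ, c, rfl, _⟩
  exacts [⟨_, rfl⟩, ⟨_, rfl⟩]

theorem ValRel.isValue (h : ValRel 𝒜 Δ n A η v) : IsValue v := by
  induction A using Ty.unfold_induction generalizing v with
  | tvar => exact (valRel_tvar.1 h).elim
  | unit => rw [valRel_unit.1 h]; exact .unit
  | nat => exact (valRel_nat.1 h).isValue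
  | prod A B ihA ihB =>
    obtain ⟨v₁, v₂, rfl, h₁, h₂⟩ := valRel_prod.1 h
    exact .pair (ihA h₁) (ihB h₂)
  | sum A B ihA ihB =>
    rcases valRel_sum.1 h with ⟨u, rfl, h'⟩ | ⟨u, rfl, h'⟩
    exacts [.inl (ihA h'), .inr (ihB h')]
  | arr A B => obtain ⟨t, rfl, _⟩ := valRel_arr.1 h; exact .lam
  | delayE A => exact (valRel_delayE.1 h).1.isValue
  | delayA A => obtain ⟨t, rfl, _⟩ := valRel_delayA.1 h; exact .dfix
  | fix A ih => obtain ⟨u, rfl, h'⟩ := valRel_fix.1 h; exact .into (ih h')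
  | box A => obtain ⟨t, rfl, _⟩ := valRel_box.1 h; exact .box

theorem ValRel.mono (h : ValRel 𝒜 Δ n A η v) (hη : η ≤ η') : ValRel 𝒜 Δ n A η' v := by
  induction A using Ty.unfold_induction generalizing v with
  | tvar => exact (valRel_tvar.1 h).elim
  | unit => exact valRel_unit.2 (valRel_unit.1 h)
  | nat => exact valRel_nat.2 (valRel_nat.1 h)
  | prod A B ihA ihB =>
    obtain ⟨v₁, v₂, rfl, h₁, h₂⟩ := valRel_prod.1 h
    exact valRel_prod.2 ⟨v₁, v₂, rfl, ihA h₁, ihB h₂⟩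
  | sum A B ihA ihB =>
    rcases valRel_sum.1 h with ⟨u, rfl, h'⟩ | ⟨u, rfl, h'⟩
    exacts [valRel_sum.2 (.inl ⟨u, rfl, ihA h'⟩), valRel_sum.2 (.inr ⟨u, rfl, ihB h'⟩)]
  | arr A B =>
    obtain ⟨t, rfl, h'⟩ := valRel_arr.1 h
    exact valRel_arr.2 ⟨t, rfl, fun σ u hσ hu => h' σ u (hη.trans hσ) hu⟩
  | delayE A =>
    obtain ⟨hd, h'⟩ := valRel_delayE.1 h
    exact valRel_delayE.2 ⟨hd, fun m hm Θ hΘ κ w hw η'' hη'' =>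
      h' m hm Θ hΘ κ w hw η'' (hη.trans hη'')⟩
  | delayA A => exact valRel_delayA.2 (valRel_delayA.1 h)
  | fix A ih =>
    obtain ⟨u, rfl, h'⟩ := valRel_fix.1 h
    exact valRel_fix.2 ⟨u, rfl, ih h'⟩
  | box A => exact valRel_box.2 (valRel_box.1 h)

/-- Values of stable types do not depend on the heap, and they stay good when time passes. -/
theorem ValRel.of_stable (hA : A.stable = true) (h : ValRel 𝒜 Δ n A η v) (hm : m ≤ n) :
    ValRel 𝒜 Δ m A η' v := by
  induction A generalizing v with
  | unit => exact valRel_unit.2 (valRel_unit.1 h)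
  | nat => exact valRel_nat.2 (valRel_nat.1 h)
  | prod A B ihA ihB =>
    simp only [Ty.stable, Bool.and_eq_true] at hA
    obtain ⟨v₁, v₂, rfl, h₁, h₂⟩ := valRel_prod.1 h
    exact valRel_prod.2 ⟨v₁, v₂, rfl, ihA hA.1 h₁, ihB hA.2 h₂⟩
  | sum A B ihA ihB =>
    simp only [Ty.stable, Bool.and_eq_true] at hA
    rcases valRel_sum.1 h with ⟨u, rfl, h'⟩ | ⟨u, rfl, h'⟩
    · exact valRel_sum.2 (.inl ⟨u, rfl, ihA hA.1 h'⟩)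
    · exact valRel_sum.2 (.inr ⟨u, rfl, ihB hA.2 h'⟩)
  | delayA A =>
    obtain ⟨t, rfl, h'⟩ := valRel_delayA.1 h
    exact valRel_delayA.2 ⟨t, rfl, fun k hk => h' k (hk.trans_le hm)⟩
  | box A =>
    obtain ⟨t, rfl, h'⟩ := valRel_box.1 h
    exact valRel_box.2 ⟨t, rfl, fun k hk => h' k (hk.trans hm)⟩
  | _ => cases hA

/-! ### Values of value types -/

theorem IsNumeral.hasType {Γ : Ctx} (h : IsNumeral v) : HasType Δ Γ v .nat := by
  induction h with
  | zero => exact .zero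
  | suc _ ih => exact .suc ih

theorem IsNumeral.of_hasType {Γ : Ctx} (hv : IsValue v) (hΓ : Γ = []) (h : HasType Δ Γ v A)
    (hA : A = .nat) : IsNumeral v := by
  induction hv with
  | zero => exact .zero
  | suc _ ih => subst hA; cases h with | suc h => exact .suc (ih h)
  | var => cases h; simp at hΓ
  | _ => subst hA; cases h

theorem ValRel.valueOfType (hA : A.IsValueType) (h : ValRel 𝒜 Δ n A η v) : ValueOfType v A := by
  induction hA generalizing v with
  | unit => rw [valRel_unit.1 h]; exact ⟨.unit, .unit⟩
  | nat => exact ⟨(valRel_nat.1 h).isValue, (valRel_nat.1 h).hasType⟩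
  | prod _ _ ihA ihB =>
    obtain ⟨v₁, v₂, rfl, h₁, h₂⟩ := valRel_prod.1 h
    exact ⟨.pair (ihA h₁).1 (ihB h₂).1, .pair (ihA h₁).2 (ihB h₂).2⟩
  | sum _ _ ihA ihB =>
    rcases valRel_sum.1 h with ⟨u, rfl, h'⟩ | ⟨u, rfl, h'⟩
    · exact ⟨.inl (ihA h').1, .inl (ihA h').2⟩
    · exact ⟨.inr (ihB h').1, .inr (ihB h').2⟩

theorem ValueOfType.valRel (hA : A.IsValueType) (h : ValueOfType v A) : ValRel 𝒜 Δ n A η v := by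
  induction hA generalizing v with
  | unit =>
    obtain ⟨hv, h⟩ := h
    generalize hΓ : ([] : Ctx) = Γ at h
    cases hv with
    | unit => exact valRel_unit.2 rfl
    | var => cases h; simp at hΓ
    | _ => cases h
  | nat => exact valRel_nat.2 (IsNumeral.of_hasType h.1 rfl h.2 rfl)
  | prod _ _ ihA ihB =>
    obtain ⟨hv, h⟩ := h
    generalize hΓ : ([] : Ctx) = Γ at h
    cases hv with
    | pair hv₁ hv₂ =>
      cases h with
      | pair h₁ h₂ =>
        subst hΓ
        exact valRel_prod.2 ⟨_, _, rfl, ihA ⟨hv₁, h₁⟩, ihB ⟨hv₂, h₂⟩⟩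
    | var => cases h; simp at hΓ
    | _ => cases h
  | sum _ _ ihA ihB =>
    obtain ⟨hv, h⟩ := h
    generalize hΓ : ([] : Ctx) = Γ at h
    cases hv with
    | inl hv => cases h with | inl h => subst hΓ; exact valRel_sum.2 (.inl ⟨_, rfl, ihA ⟨hv, h⟩⟩)
    | inr hv => cases h with | inr h => subst hΓ; exact valRel_sum.2 (.inr ⟨_, rfl, ihB ⟨hv, h⟩⟩)
    | var => cases h; simp at hΓ
    | _ => cases h

/-- The next input on a channel is a good delayed value over any heap. -/
theorem valRel_inp {κ : Chan} {c : ChanClass} (hκ : Δ.Has κ c A) :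
    ValRel 𝒜 Δ n (.delayE A) η (.inp κ) := by
  induction n generalizing η with
  | zero => exact valRel_delayE.2 ⟨.inr ⟨κ, c, rfl, hκ⟩, fun m hm => by omega⟩
  | succ n ih =>
    refine valRel_delayE.2 ⟨.inr ⟨κ, c, rfl, hκ⟩, ?_⟩
    intro m hm Θ hΘ κ' w hw η' hη' ηL hηL
    obtain rfl : m = n := by omega
    obtain rfl : ({κ} : Clock) = Θ := by simpa [Clk.eval] using hΘ
    refine ⟨fun hκ' => ?_, fun _ => ih⟩
    obtain rfl : κ' = κ := by simpa using hκ'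
    obtain ⟨c', A', hκ', hw⟩ := hw
    obtain ⟨rfl, rfl⟩ : c' = c ∧ A' = A := by
      rw [InputCtx.Has, hκ] at hκ'
      simpa [eq_comm] using hκ'
    exact fun ι _ => ⟨w, _, .advInp, le_rfl, hw.valRel (Δ.isValueType _ _ _ hκ)⟩

end Relation
/-! ### Variables of contexts and clock expressions -/

namespace Ctx

/-- The type of a variable in a context. -/
def lookup : Ctx → ℕ → Option Ty
  | [], _ => none
  | .var A :: _, 0 => some A
  | .var _ :: Γ, i + 1 => lookup Γ i
  | .tick _ :: Γ, i => lookup Γ i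

theorem lookup_append (Γ' Γ : Ctx) (i : ℕ) : (Γ' ++ Γ).lookup (i + Γ'.nvars) = Γ.lookup i := by
  induction Γ' with
  | nil => rfl
  | cons e Γ' ih => cases e <;> exact ih

theorem lookup_append_var (Γ' Γ : Ctx) (A : Ty) :
    (Γ' ++ .var A :: Γ).lookup Γ'.nvars = some A := by
  simpa [lookup] using lookup_append Γ' (.var A :: Γ) 0

theorem TickFree.tail {e : Entry} {Γ : Ctx} (h : TickFree (e :: Γ)) : TickFree Γ :=
  fun θ hθ => h θ (List.mem_cons_of_mem _ hθ)

theorem not_tickFree_tick {θ : Clk} {Γ : Ctx} : ¬TickFree (.tick θ :: Γ) :=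
  fun h => h θ List.mem_cons_self

theorem tickFree_stab (Γ : Ctx) : Γ.stab.TickFree := by
  intro θ
  induction Γ with
  | nil => simp [stab]
  | cons e Γ ih =>
    cases e with
    | var A =>
      simp only [stab]
      split <;> simp [ih]
    | tick _ => exact ih

theorem lookup_stab {Γ : Ctx} {i : ℕ} {A : Ty} (h : Γ.stab.lookup i = some A) :
    Γ.lookup (Γ.stabRen i) = some A ∧ A.stable = true := by
  induction Γ generalizing i with
  | nil => cases h
  | cons e Γ ih =>
    cases e with
    | var B =>
      simp only [stab, stabRen] at h ⊢
      split at h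
      next hB =>
        rw [if_pos hB]
        cases i with
        | zero => cases h; exact ⟨rfl, hB⟩
        | succ i => exact ih h
      next hB =>
        rw [if_neg hB]
        exact ih h
    | tick θ => exact ih h

end Ctx

theorem WfCtx.tickFree_of_append {Δ : InputCtx} {Γ Γ' : Ctx} {θ : Clk}
    (h : WfCtx Δ (Γ' ++ .tick θ :: Γ)) : Γ'.TickFree := by
  induction Γ' with
  | nil => intro θ'; simp
  | cons e Γ' ih =>
    intro θ' hθ'
    cases h with
    | var h => exact ih h θ' (by simpa using hθ')
    | tick _ _ h => exact h θ (by simp)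

/-- `θ.HasVar i` says that `cl x` is one of the atoms of `θ`, where `x` is the variable `i`. -/
def Clk.HasVar (i : ℕ) : Clk → Prop
  | .cl v => v = .var i
  | .join θ θ' => θ.HasVar i ∨ θ'.HasVar i

theorem ClkEq.hasVar_iff {θ θ' : Clk} (h : ClkEq θ θ') (i : ℕ) : θ.HasVar i ↔ θ'.HasVar i := by
  induction h with
  | refl => rfl
  | symm _ ih => exact ih.symm
  | trans _ _ ih₁ ih₂ => exact ih₁.trans ih₂
  | congr _ _ ih₁ ih₂ => simp only [Clk.HasVar, ih₁, ih₂]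
  | assoc => simp only [Clk.HasVar, or_assoc]
  | comm => simp only [Clk.HasVar, or_comm]
  | idem => simp only [Clk.HasVar, or_self]

theorem ClkEq.eval_subst {θ θ' : Clk} (h : ClkEq θ θ') (γ : ℕ → Tm) :
    (θ.subst γ).eval = (θ'.subst γ).eval := by
  induction h with
  | refl => rfl
  | symm _ ih => exact ih.symm
  | trans _ _ ih₁ ih₂ => exact ih₁.trans ih₂
  | congr _ _ ih₁ ih₂ => simp only [Clk.subst, Clk.eval, ih₁, ih₂]
  | assoc => exact Option.map₂_assoc Finset.union_assoc
  | comm => exact Option.map₂_comm Finset.union_comm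
  | idem θ =>
    simp only [Clk.subst, Clk.eval]
    cases (θ.subst γ).eval <;> simp

theorem Clk.HasVar.clock_subset {θ : Clk} {i : ℕ} {γ : ℕ → Tm} {Θ Θ' : Clock}
    (h : θ.HasVar i) (hΘ : (θ.subst γ).eval = some Θ) (hΘ' : (Clk.cl (γ i)).eval = some Θ') :
    Θ' ⊆ Θ := by
  induction θ using Clk.rec (motive_1 := fun _ => True) generalizing Θ with
  | cl v =>
    obtain rfl : v = .var i := h
    simp only [Clk.subst, Tm.subst] at hΘ
    rw [hΘ] at hΘ'
    cases hΘ'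
    exact subset_rfl
  | join θ₁ θ₂ ih₁ ih₂ =>
    simp only [Clk.subst, Clk.eval, Option.map₂_eq_some_iff] at hΘ
    obtain ⟨Θ₁, Θ₂, h₁, h₂, rfl⟩ := hΘ
    rcases h with h | h
    · exact (ih₁ h h₁).trans Finset.subset_union_left
    · exact (ih₂ h h₂).trans Finset.subset_union_right
  | _ => trivial

theorem HasType.lookup_var {Δ : InputCtx} {Γ : Ctx} {i : ℕ} {A : Ty}
    (h : HasType Δ Γ (.var i) A) : Γ.lookup i = some A := by
  cases h
  exact Ctx.lookup_append_var _ _ _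

/-- The values of a type `delayE A` are variables and input channels. -/
theorem HasType.delayE_cases {Δ : InputCtx} {Γ : Ctx} {v : Tm} {A : Ty} (hv : IsValue v)
    (h : HasType Δ Γ v (.delayE A)) :
    (∃ i, v = .var i ∧ Γ.lookup i = some (.delayE A)) ∨ ∃ κ c, v = .inp κ ∧ Δ.Has κ c A := by
  cases hv with
  | var => exact .inl ⟨_, rfl, h.lookup_var⟩
  | inp => cases h with | inp h => exact .inr ⟨_, _, rfl, h⟩
  | _ => cases h

theorem IsClock.exists_eval {Δ : InputCtx} {Γ : Ctx} {θ : Clk} {γ : ℕ → Tm}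
    (h : IsClock Δ Γ θ)
    (hγ : ∀ i A, Γ.lookup i = some (.delayE A) → ∃ Θ, (Clk.cl (γ i)).eval = some Θ) :
    ∃ Θ, (θ.subst γ).eval = some Θ := by
  induction θ using Clk.rec (motive_1 := fun _ => True) with
  | cl v =>
    cases h with
    | cl hv h =>
      rcases h.delayE_cases hv with ⟨i, rfl, hi⟩ | ⟨κ, c, rfl, _⟩
      · exact hγ i _ hi
      · exact ⟨_, rfl⟩
  | join θ₁ θ₂ ih₁ ih₂ =>
    cases h with
    | join h₁ h₂ =>
      obtain ⟨Θ₁, h₁⟩ := ih₁ h₁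
      obtain ⟨Θ₂, h₂⟩ := ih₂ h₂
      exact ⟨Θ₁ ∪ Θ₂, by simp [Clk.subst, Clk.eval, h₁, h₂]⟩
  | _ => trivial

/-! ### Environments -/

/-- The part of an environment that can be used to the right of a tick on `θ`: the values of the
variables of stable type, and the values of the delayed variables that occur in the clock `θ`. -/
def TickEnvRel (𝒜 : Allocator) (Δ : InputCtx) (n : ℕ) (Γ : Ctx) (θ : Clk) (η : Heap)
    (γ : ℕ → Tm) : Prop :=
  ∀ i A, Γ.lookup i = some A → (A.stable = true ∨ (∃ B, A = .delayE B) ∧ θ.HasVar i) →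
    ValRel 𝒜 Δ n A η (γ i)

/-- The environment relation. To the right of a tick the store has just been updated by an input on
the clock of the tick; the variables to the left of the tick are taken at the time before that
input, when one more input was to come and the heap `η` was not yet split. -/
def EnvRel (𝒜 : Allocator) (Δ : InputCtx) (n : ℕ) : Ctx → Store → (ℕ → Tm) → Prop
  | [], _, _ => True
  | .var A :: Γ, σ, γ => ValRel 𝒜 Δ n A σ.later (γ 0) ∧ EnvRel 𝒜 Δ n Γ σ fun i => γ (i + 1)
  | .tick θ :: Γ, σ, γ => ∃ η κ w ηL Θ, σ = .two (η.clockIn κ) κ w ηL ∧ η.clockNotIn κ ≤ ηL ∧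
      InputTyped Δ κ w ∧ (θ.subst γ).eval = some Θ ∧ κ ∈ Θ ∧ TickEnvRel 𝒜 Δ (n + 1) Γ θ η γ

section Environments

variable {𝒜 : Allocator} {Δ : InputCtx} {n m : ℕ} {Γ Γ' : Ctx} {A : Ty} {θ : Clk} {σ τ : Store}
  {η : Heap} {γ : ℕ → Tm} {i : ℕ}

theorem EnvRel.mono (h : EnvRel 𝒜 Δ n Γ σ γ) (hσ : σ ≤ τ) : EnvRel 𝒜 Δ n Γ τ γ := by
  induction Γ generalizing γ with
  | nil => trivial
  | cons e Γ ih =>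
    cases e with
    | var A => exact ⟨h.1.mono (Store.later_mono hσ), ih h.2⟩
    | tick θ =>
      obtain ⟨η, κ, w, ηL, Θ, rfl, hη, h⟩ := h
      cases hσ with
      | two hL => exact ⟨η, κ, w, _, Θ, rfl, hη.trans hL, h⟩

theorem EnvRel.of_append (hΓ' : Γ'.TickFree) (h : EnvRel 𝒜 Δ n (Γ' ++ Γ) σ γ) :
    EnvRel 𝒜 Δ n Γ σ fun i => γ (i + Γ'.nvars) := by
  induction Γ' generalizing γ with
  | nil => exact h
  | cons e Γ' ih =>
    cases e with
    | var A => exact ih hΓ'.tail h.2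
    | tick θ => exact (Ctx.not_tickFree_tick hΓ').elim

theorem EnvRel.valRel_of_tickFree (hΓ : Γ.TickFree) (h : EnvRel 𝒜 Δ n Γ σ γ)
    (hi : Γ.lookup i = some A) : ValRel 𝒜 Δ n A σ.later (γ i) := by
  induction Γ generalizing γ i with
  | nil => cases hi
  | cons e Γ ih =>
    cases e with
    | var B =>
      cases i with
      | zero => cases hi; exact h.1
      | succ i => exact ih (γ := fun i => γ (i + 1)) hΓ.tail h.2 hi
    | tick θ => exact (Ctx.not_tickFree_tick hΓ).elim

theorem EnvRel.valRel_of_stable (hA : A.stable = true) (h : EnvRel 𝒜 Δ n Γ σ γ)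
    (hi : Γ.lookup i = some A) : ValRel 𝒜 Δ n A σ.later (γ i) := by
  induction Γ generalizing γ i with
  | nil => cases hi
  | cons e Γ ih =>
    cases e with
    | var B =>
      cases i with
      | zero => cases hi; exact h.1
      | succ i => exact ih (γ := fun i => γ (i + 1)) h.2 hi
    | tick θ =>
      obtain ⟨_, _, _, _, _, _, _, _, _, _, h⟩ := h
      exact (h i A hi (.inl hA)).of_stable hA n.le_succ

theorem EnvRel.of_lookup (hΓ : Γ.TickFree)
    (h : ∀ i A, Γ.lookup i = some A → ValRel 𝒜 Δ n A σ.later (γ i)) :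
    EnvRel 𝒜 Δ n Γ σ γ := by
  induction Γ generalizing γ with
  | nil => trivial
  | cons e Γ ih =>
    cases e with
    | var B => exact ⟨h 0 B rfl, ih hΓ.tail fun i A hi => h (i + 1) A hi⟩
    | tick θ => exact (Ctx.not_tickFree_tick hΓ).elim

theorem EnvRel.of_tickFree (hΓ : Γ.TickFree) (h : EnvRel 𝒜 Δ n Γ σ γ)
    (hσ : σ.later ≤ τ.later) : EnvRel 𝒜 Δ n Γ τ γ :=
  .of_lookup hΓ fun _ _ hi => (h.valRel_of_tickFree hΓ hi).mono hσ

theorem EnvRel.stab (h : EnvRel 𝒜 Δ n Γ σ γ) (hm : m ≤ n) :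
    EnvRel 𝒜 Δ m Γ.stab τ (γ ∘ Γ.stabRen) :=
  .of_lookup Γ.tickFree_stab fun _ _ hi =>
    (h.valRel_of_stable (Ctx.lookup_stab hi).2 (Ctx.lookup_stab hi).1).of_stable
      (Ctx.lookup_stab hi).2 hm

theorem TickEnvRel.valRel {v : Tm} (h : TickEnvRel 𝒜 Δ n Γ θ η γ) (hv : IsValue v)
    (ht : HasType Δ Γ v (.delayE A)) (hθ : ∀ i, v = .var i → θ.HasVar i) :
    ValRel 𝒜 Δ n (.delayE A) η (v.subst γ) := by
  rcases ht.delayE_cases hv with ⟨i, rfl, hi⟩ | ⟨κ, c, rfl, hκ⟩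
  · exact h i _ hi (.inr ⟨⟨A, rfl⟩, hθ i rfl⟩)
  · exact valRel_inp hκ

/-- A location that holds a delayed term is a good value. The relevant part of the environment
persists until the clock ticks, because the clock of the location contains the clocks of all delayed
variables in `θ`. -/
theorem valRel_loc {t : Tm} {l : Loc}
    (ht : ∀ n σ γ, EnvRel 𝒜 Δ n (.tick θ :: Γ) σ γ →
      ExpRel 𝒜 Δ (ValRel 𝒜 Δ n A) σ (t.subst γ))
    (hγ : TickEnvRel 𝒜 Δ n Γ θ η γ) (hθ : (θ.subst γ).eval = some l.clock)
    (hl : η.get l = some (t.subst γ)) : ValRel 𝒜 Δ n (.delayE A) η (.loc l) := by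
  induction n generalizing η with
  | zero => exact valRel_delayE.2 ⟨.inl ⟨l, rfl⟩, fun m hm => by omega⟩
  | succ n ih =>
    refine valRel_delayE.2 ⟨.inl ⟨l, rfl⟩, ?_⟩
    intro m hm Θ hΘ κ w hw η' hη' ηL hηL
    obtain rfl : m = n := by omega
    obtain rfl : l.clock = Θ := by simpa [Clk.eval] using hΘ
    constructor
    · intro hκ ι hι
      obtain ⟨v, τ, he, hτ, hv⟩ := ht m (.two (η'.clockIn κ) κ w ηL) γ
        ⟨η', κ, w, ηL, _, rfl, hηL, hw, hθ, hκ, fun i B hi hB => (hγ i B hi hB).mono hη'⟩ ι hι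
      exact ⟨v, τ, .advLoc (by simpa [Heap.clockIn, hκ] using hη' l _ hl) he, hτ, hv⟩
    · intro hκ
      refine ih ?_ (hηL l _ (by simpa [Heap.clockNotIn, hκ] using hη' l _ hl))
      intro i B hi hB
      by_cases hs : B.stable = true
      · exact (hγ i B hi hB).of_stable hs m.le_succ
      · obtain ⟨⟨C, rfl⟩, hvar⟩ := hB.resolve_left hs
        obtain ⟨hd, h⟩ := valRel_delayE.1 (hγ i _ hi hB)
        obtain ⟨Θ', hΘ'⟩ := hd.exists_eval
        exact (h m rfl Θ' hΘ' κ w hw η' hη' ηL hηL).2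
          fun hmem => hκ (hvar.clock_subset hθ hΘ' hmem)

/-- The location that stands for `never` is good over any heap, since its clock is empty. -/
theorem valRel_loc_of_clock_eq_empty {l : Loc} (hl : l.clock = ∅) :
    ValRel 𝒜 Δ n (.delayE A) η (.loc l) := by
  induction n generalizing η with
  | zero => exact valRel_delayE.2 ⟨.inl ⟨l, rfl⟩, fun m hm => by omega⟩
  | succ n ih =>
    refine valRel_delayE.2 ⟨.inl ⟨l, rfl⟩, ?_⟩
    intro m hm Θ hΘ κ w hw η' hη' ηL hηL
    obtain rfl : m = n := by omega
    obtain rfl : l.clock = Θ := by simpa [Clk.eval] using hΘ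
    exact ⟨fun hκ => by simp [hl] at hκ, fun _ => ih⟩

end Environments

/-! ### The fundamental property -/

section Fundamental

variable {𝒜 : Allocator} {Δ : InputCtx} {n : ℕ} {A : Ty}

/-- Primitive recursion on a numeral, by induction on the numeral. -/
theorem ExpRel.recN {s t u : Tm} {σ : Store} (hu : IsNumeral u)
    (hs : ∀ τ, σ ≤ τ → ExpRel 𝒜 Δ (ValRel 𝒜 Δ n A) τ s)
    (ht : ∀ τ, σ ≤ τ → ∀ v w, IsNumeral v → ValRel 𝒜 Δ n A τ.later w →
      ExpRel 𝒜 Δ (ValRel 𝒜 Δ n A) τ (t.inst₂ v w)) :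
    ExpRel 𝒜 Δ (ValRel 𝒜 Δ n A) σ (.recN s t u) := by
  intro ι hι
  induction hu with
  | zero =>
    obtain ⟨v, τ, he, h⟩ := hs σ le_rfl ι hι
    exact ⟨v, τ, .recZero (.value .zero) he, h⟩
  | suc hu ih =>
    obtain ⟨w, τ, he, hτ, hw⟩ := ih
    obtain ⟨w', τ', he', hτ', hw'⟩ := ht τ hτ _ w hu hw ι hι
    exact ⟨w', τ', .recSuc (.value (.suc hu.isValue)) he he', hτ.trans hτ', hw'⟩

/-- The fundamental property of the logical relation: well-typed terms, closed by good
environments, evaluate to good values. -/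
theorem HasType.expRel {Γ : Ctx} {t : Tm} (h : HasType Δ Γ t A) :
    ∀ n σ γ, EnvRel 𝒜 Δ n Γ σ γ → ExpRel 𝒜 Δ (ValRel 𝒜 Δ n A) σ (t.subst γ) := by
  refine HasType.rec
    (motive_1 := fun Γ t A _ => ∀ n σ γ, EnvRel 𝒜 Δ n Γ σ γ →
      ExpRel 𝒜 Δ (ValRel 𝒜 Δ n A) σ (t.subst γ))
    (motive_2 := fun _ _ _ => True) (motive_3 := fun _ _ => True)
    ?var ?unit ?letin ?lam ?app ?inl ?inr ?case ?pair ?fst ?snd ?delay ?never ?inp ?buf ?adv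
    ?advVar ?select ?zero ?suc ?recN ?fix ?box ?unbox ?out ?into
    (fun _ _ _ => trivial) (fun _ _ _ _ => trivial) trivial (fun _ _ => trivial)
    (fun _ _ _ _ _ => trivial) h
  case var =>
    intro Γ Γ' A hA _ _ n σ γ hγ ι hι
    have hv : ValRel 𝒜 Δ n A σ.later (γ Γ'.nvars) := by
      rcases hA with hA | hA
      · simpa using (hγ.of_append hA).1
      · exact hγ.valRel_of_stable hA (Ctx.lookup_append_var _ _ _)
    exact ⟨_, σ, .value hv.isValue, le_rfl, hv⟩
  case unit =>
    intro Γ n σ γ _ ι _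
    exact ⟨.unit, σ, .value .unit, le_rfl, valRel_unit.2 rfl⟩
  case letin =>
    intro Γ s t A B _ _ ihs iht n σ γ hγ ι hι
    obtain ⟨v, τ, he, hτ, hv⟩ := ihs n σ γ hγ ι hι
    obtain ⟨v', τ', he', hτ', hv'⟩ := iht n τ (scons v γ) ⟨hv, hγ.mono hτ⟩ ι hι
    rw [← Tm.subst_up_inst] at he'
    exact ⟨v', τ', .letin he he', hτ.trans hτ', hv'⟩
  case lam =>
    intro Γ t A B _ hΓ ih n σ γ hγ ι _
    refine ⟨_, σ, .value .lam, le_rfl, valRel_arr.2 ⟨_, rfl, fun τ u hτ hu => ?_⟩⟩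
    rw [Tm.subst_up_inst]
    exact ih n τ (scons u γ) ⟨hu, hγ.of_tickFree hΓ hτ⟩
  case app =>
    intro Γ t t' A B _ _ iht iht' n σ γ hγ ι hι
    obtain ⟨v, τ, he, hτ, hv⟩ := iht n σ γ hγ ι hι
    obtain ⟨s, rfl, hs⟩ := valRel_arr.1 hv
    obtain ⟨v', τ', he', hτ', hv'⟩ := iht' n τ γ (hγ.mono hτ) ι hι
    obtain ⟨w, τ'', he'', hτ'', hw⟩ := hs τ' v' (Store.later_mono hτ') hv' ι hι
    exact ⟨w, τ'', .app he he' he'', (hτ.trans hτ').trans hτ'', hw⟩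
  case inl =>
    intro Γ t A B _ ih n σ γ hγ ι hι
    obtain ⟨v, τ, he, hτ, hv⟩ := ih n σ γ hγ ι hι
    exact ⟨_, τ, .inl he, hτ, valRel_sum.2 (.inl ⟨v, rfl, hv⟩)⟩
  case inr =>
    intro Γ t A B _ ih n σ γ hγ ι hι
    obtain ⟨v, τ, he, hτ, hv⟩ := ih n σ γ hγ ι hι
    exact ⟨_, τ, .inr he, hτ, valRel_sum.2 (.inr ⟨v, rfl, hv⟩)⟩
  case case =>
    intro Γ t t₁ t₂ A₁ A₂ B _ _ _ ih₁ ih₂ ih n σ γ hγ ι hι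
    obtain ⟨v, τ, he, hτ, hv⟩ := ih n σ γ hγ ι hι
    rcases valRel_sum.1 hv with ⟨u, rfl, hu⟩ | ⟨u, rfl, hu⟩
    · obtain ⟨w, τ', he', hτ', hw⟩ := ih₁ n τ (scons u γ) ⟨hu, hγ.mono hτ⟩ ι hι
      rw [← Tm.subst_up_inst] at he'
      exact ⟨w, τ', .caseInl he he', hτ.trans hτ', hw⟩
    · obtain ⟨w, τ', he', hτ', hw⟩ := ih₂ n τ (scons u γ) ⟨hu, hγ.mono hτ⟩ ι hι
      rw [← Tm.subst_up_inst] at he'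
      exact ⟨w, τ', .caseInr he he', hτ.trans hτ', hw⟩
  case pair =>
    intro Γ t t' A B _ _ iht iht' n σ γ hγ ι hι
    obtain ⟨v, τ, he, hτ, hv⟩ := iht n σ γ hγ ι hι
    obtain ⟨v', τ', he', hτ', hv'⟩ := iht' n τ γ (hγ.mono hτ) ι hι
    exact ⟨_, τ', .pair he he', hτ.trans hτ',
      valRel_prod.2 ⟨v, v', rfl, hv.mono (Store.later_mono hτ'), hv'⟩⟩
  case fst =>
    intro Γ t A B _ ih n σ γ hγ ι hι
    obtain ⟨v, τ, he, hτ, hv⟩ := ih n σ γ hγ ι hι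
    obtain ⟨v₁, v₂, rfl, h₁, _⟩ := valRel_prod.1 hv
    exact ⟨v₁, τ, .fst he, hτ, h₁⟩
  case snd =>
    intro Γ t A B _ ih n σ γ hγ ι hι
    obtain ⟨v, τ, he, hτ, hv⟩ := ih n σ γ hγ ι hι
    obtain ⟨v₁, v₂, rfl, _, h₂⟩ := valRel_prod.1 hv
    exact ⟨v₂, τ, .snd he, hτ, h₂⟩
  case delay =>
    intro Γ θ t A _ hθ hΓ ih _ n σ γ hγ ι _
    have hlook : ∀ i B, Γ.lookup i = some B → ValRel 𝒜 Δ n B σ.later (γ i) :=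
      fun i B hi => hγ.valRel_of_tickFree hΓ hi
    obtain ⟨Θ, hΘ⟩ := hθ.exists_eval fun i B hi =>
      (valRel_delayE.1 (hlook i _ hi)).1.exists_eval
    have hle : σ ≤ σ.insert (𝒜.alloc Θ σ) (t.subst γ) :=
      Store.le_insert _ (𝒜.alloc_fresh Θ σ)
    refine ⟨_, _, .delay hΘ, hle, valRel_loc ih ?_ ?_ (Store.insert_later_get _ _ _)⟩
    · exact fun i B hi _ => (hlook i B hi).mono (Store.later_mono hle)
    · rw [hΘ, 𝒜.clock_alloc]
  case never =>
    intro Γ A n σ γ _ ι _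
    exact ⟨_, σ, .never, le_rfl, valRel_loc_of_clock_eq_empty (𝒜.clock_alloc _ _)⟩
  case inp =>
    intro Γ κ c A hκ _ n σ γ _ ι _
    exact ⟨.inp κ, σ, .value .inp, le_rfl, valRel_inp hκ⟩
  case buf =>
    intro Γ κ c A hκ hc n σ γ _ ι hι
    obtain ⟨v, hv, hvA⟩ := hι κ c A hκ hc
    exact ⟨v, σ, .buf hv, le_rfl, hvA.valRel (Δ.isValueType _ _ _ hκ)⟩
  case adv =>
    intro Γ Γ' v A hv ht hwf _ _ n σ γ hγ
    obtain ⟨η, κ, w, ηL, Θ, rfl, hη, hw, hΘ, hκ, h⟩ := hγ.of_append hwf.tickFree_of_append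
    have hval := h.valRel hv ht fun i hi => hi
    simp only [Tm.subst, Tm.subst_of_rename]
    exact ((valRel_delayE.1 hval).2 n rfl Θ hΘ κ w hw η le_rfl ηL hη).1 hκ
  case advVar =>
    intro Γ Γ' θ i A ht hwf _ _ n σ γ hγ ι hι
    obtain ⟨η, κ, w, ηL, Θ, rfl, hη, hw, hΘ, hκ, h⟩ := hγ.of_append hwf.tickFree_of_append
    obtain ⟨t, ht', hE⟩ := valRel_delayA.1 (h i _ ht.lookup_var (.inl rfl))
    obtain ⟨v, τ, he, hv⟩ := hE n n.lt_succ_self (.two (η.clockIn κ) κ w ηL) ι hι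
    refine ⟨v, τ, ?_, hv⟩
    simp only [Tm.subst, ht']
    exact .advDfix he
  case select =>
    intro Γ Γ' θ v₁ v₂ A₁ A₂ hv₁ hv₂ ht₁ ht₂ hθ hwf _ _ _ n σ γ hγ ι hι
    obtain ⟨η, κ, w, ηL, Θ, rfl, hη, hw, hΘ, hκ, h⟩ := hγ.of_append hwf.tickFree_of_append
    have h₁ := h.valRel hv₁ ht₁ fun i hi => (hθ.hasVar_iff i).2 (.inl hi)
    have h₂ := h.valRel hv₂ ht₂ fun i hi => (hθ.hasVar_iff i).2 (.inr hi)
    simp only [Tm.subst, Tm.subst_of_rename]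
    rw [hθ.eval_subst] at hΘ
    simp only [Clk.subst, Clk.eval, Option.map₂_eq_some_iff] at hΘ
    obtain ⟨Θ₁, Θ₂, hΘ₁, hΘ₂, rfl⟩ := hΘ
    have h₁ := (valRel_delayE.1 h₁).2 n rfl Θ₁ hΘ₁ κ w hw η le_rfl
    have h₂ := (valRel_delayE.1 h₂).2 n rfl Θ₂ hΘ₂ κ w hw η le_rfl
    by_cases hκ₁ : κ ∈ Θ₁
    · obtain ⟨u₁, τ, he, hτ, hu₁⟩ := (h₁ ηL hη).1 hκ₁ ι hι
      cases hτ with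
      | @two _ _ ηL' _ _ hL =>
        by_cases hκ₂ : κ ∈ Θ₂
        · obtain ⟨u₂, τ', he', hτ', hu₂⟩ := (h₂ ηL' (hη.trans hL)).1 hκ₂ ι hι
          exact ⟨_, τ', .selectBoth hΘ₁ hΘ₂ hκ₁ hκ₂ he he',
            (show Store.two _ _ _ _ ≤ Store.two _ _ _ _ from .two hL).trans hτ',
            valRel_sum.2 (.inr ⟨_, rfl, valRel_prod.2
              ⟨u₁, u₂, rfl, hu₁.mono (Store.later_mono hτ'), hu₂⟩⟩)⟩
        · exact ⟨_, _, .selectLeft hΘ₁ hΘ₂ hκ₁ hκ₂ he, .two hL,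
            valRel_sum.2 (.inl ⟨_, rfl, valRel_sum.2 (.inl ⟨_, rfl, valRel_prod.2
              ⟨u₁, _, rfl, hu₁, (h₂ ηL' (hη.trans hL)).2 hκ₂⟩⟩)⟩)⟩
    · have hκ₂ : κ ∈ Θ₂ := (Finset.mem_union.1 hκ).resolve_left hκ₁
      obtain ⟨u₂, τ, he, hτ, hu₂⟩ := (h₂ ηL hη).1 hκ₂ ι hι
      cases hτ with
      | @two _ _ ηL' _ _ hL =>
        exact ⟨_, _, .selectRight hΘ₁ hΘ₂ hκ₁ hκ₂ he, .two hL,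
          valRel_sum.2 (.inl ⟨_, rfl, valRel_sum.2 (.inr ⟨_, rfl, valRel_prod.2
            ⟨_, u₂, rfl, (h₁ ηL' (hη.trans hL)).2 hκ₁, hu₂⟩⟩)⟩)⟩
  case zero =>
    intro Γ n σ γ _ ι _
    exact ⟨.zero, σ, .value .zero, le_rfl, valRel_nat.2 .zero⟩
  case suc =>
    intro Γ t _ ih n σ γ hγ ι hι
    obtain ⟨v, τ, he, hτ, hv⟩ := ih n σ γ hγ ι hι
    exact ⟨_, τ, .suc he, hτ, valRel_nat.2 (.suc (valRel_nat.1 hv))⟩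
  case recN =>
    intro Γ s t u A _ _ _ ihs iht ihu n σ γ hγ ι hι
    obtain ⟨v, τ, he, hτ, hv⟩ := ihu n σ γ hγ ι hι
    have hrec : ExpRel 𝒜 Δ (ValRel 𝒜 Δ n A) τ
        (.recN (s.subst γ) (t.subst (up (up γ))) v) := by
      refine .recN (valRel_nat.1 hv) (fun τ' hτ' => ihs n τ' γ (hγ.mono (hτ.trans hτ'))) ?_
      intro τ' hτ' v' w hv' hw
      rw [Tm.subst_up_up_inst₂]
      exact iht n τ' _ ⟨hw, valRel_nat.2 hv', hγ.mono (hτ.trans hτ')⟩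
    obtain ⟨w, τ', he', hτ', hw⟩ := hrec ι hι
    refine ⟨w, τ', ?_, hτ.trans hτ', hw⟩
    -- Evaluation of the recursion starts by evaluating its argument to the numeral `v`.
    cases he' with
    | value hv => cases hv
    | recZero h₁ h₂ =>
      obtain ⟨rfl, rfl⟩ := h₁.eq_of_isValue (valRel_nat.1 hv).isValue
      exact .recZero he h₂
    | recSuc h₁ h₂ h₃ =>
      obtain ⟨rfl, rfl⟩ := h₁.eq_of_isValue (valRel_nat.1 hv).isValue
      exact .recSuc he h₂ h₃
  case fix =>
    intro Γ t A _ ih n σ γ hγ ι hι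
    set s := t.subst (up (γ ∘ Γ.stabRen)) with hs
    -- By induction on the number of remaining inputs, `dfix s` is good at all later times.
    have hdfix : ∀ m ≤ n, ∀ τ, ExpRel 𝒜 Δ (ValRel 𝒜 Δ m A) τ (s.inst (.dfix s)) := by
      intro m
      induction m using Nat.strong_induction_on with
      | _ m ihm =>
        intro hm τ
        rw [hs, Tm.subst_up_inst, ← hs]
        exact ih m τ _ ⟨valRel_delayA.2 ⟨s, rfl, fun k hk => ihm k hk (hk.le.trans hm)⟩,
          hγ.stab hm⟩
    obtain ⟨v, τ, he, hv⟩ := hdfix n le_rfl σ ι hι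
    refine ⟨v, τ, ?_, hv⟩
    simp only [Tm.subst, Tm.subst_of_rename, up_comp_liftRen]
    exact .fix he
  case box =>
    intro Γ t A _ ih n σ γ hγ ι _
    simp only [Tm.subst, Tm.subst_of_rename]
    exact ⟨_, σ, .value .box, le_rfl,
      valRel_box.2 ⟨_, rfl, fun m hm τ => ih m τ _ (hγ.stab hm)⟩⟩
  case unbox =>
    intro Γ t A _ ih n σ γ hγ ι hι
    obtain ⟨v, τ, he, hτ, hv⟩ := ih n σ γ hγ ι hι
    obtain ⟨s, rfl, hs⟩ := valRel_box.1 hv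
    obtain ⟨w, τ', he', hτ', hw⟩ := hs n le_rfl τ ι hι
    exact ⟨w, τ', .unbox he he', hτ.trans hτ', hw⟩
  case out =>
    intro Γ t A _ ih n σ γ hγ ι hι
    obtain ⟨v, τ, he, hτ, hv⟩ := ih n σ γ hγ ι hι
    obtain ⟨u, rfl, hu⟩ := valRel_fix.1 hv
    exact ⟨u, τ, .out he, hτ, hu⟩
  case into =>
    intro Γ t A _ ih n σ γ hγ ι hι
    obtain ⟨v, τ, he, hτ, hv⟩ := ih n σ γ hγ ι hι
    exact ⟨_, τ, .into he, hτ, valRel_fix.2 ⟨v, rfl, hv⟩⟩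

end Fundamental
/-! ### Signals and tuples of signals -/

section Signals

variable {𝒜 : Allocator} {Δ : InputCtx} {A B : Ty} {η : Heap} {v : Tm}

theorem Ty.IsValueType.rename_eq (hA : A.IsValueType) (ρ : ℕ → ℕ) : A.rename ρ = A := by
  induction hA <;> simp_all [Ty.rename]

theorem Ty.IsValueType.subst_eq (hA : A.IsValueType) (s : ℕ → Ty) : A.subst s = A := by
  induction hA <;> simp_all [Ty.subst]

theorem Ty.IsValueType.unfold_sig (hA : A.IsValueType) :
    (Ty.prod (A.rename Nat.succ) (.tvar 0)).unfold = .prod A (.delayE A.sig) := by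
  simp only [Ty.unfold, Ty.inst, Ty.subst, Ty.sig, hA.rename_eq, hA.subst_eq]

/-- The values that behave well for any number of inputs. -/
def LimitRel (𝒜 : Allocator) (Δ : InputCtx) (A : Ty) (η : Heap) (v : Tm) : Prop :=
  ∀ n, ValRel 𝒜 Δ n A η v

theorem LimitRel.prod_cases (h : LimitRel 𝒜 Δ (.prod A B) η v) :
    ∃ v₁ v₂, v = .pair v₁ v₂ ∧ LimitRel 𝒜 Δ A η v₁ ∧ LimitRel 𝒜 Δ B η v₂ := by
  obtain ⟨v₁, v₂, rfl, _⟩ := valRel_prod.1 (h 0)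
  refine ⟨v₁, v₂, rfl, fun n => ?_, fun n => ?_⟩
  · obtain ⟨_, _, he, h', _⟩ := valRel_prod.1 (h n)
    cases he
    exact h'
  · obtain ⟨_, _, he, _, h'⟩ := valRel_prod.1 (h n)
    cases he
    exact h'

/-- Evaluation is deterministic, so a term that evaluates to a good value for each number of inputs
evaluates to a single value that is good for all of them. -/
theorem exists_eval_limitRel {ι : Buffer} {σ : Store} {t : Tm} (hι : BufferTyped Δ ι)
    (h : ∀ n, ExpRel 𝒜 Δ (ValRel 𝒜 Δ n A) σ t) :
    ∃ v τ, Eval 𝒜 ι t σ v τ ∧ σ ≤ τ ∧ LimitRel 𝒜 Δ A τ.later v := by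
  obtain ⟨v, τ, he, hτ, _⟩ := h 0 ι hι
  refine ⟨v, τ, he, hτ, fun n => ?_⟩
  obtain ⟨v', τ', he', _, hv'⟩ := h n ι hι
  obtain ⟨rfl, rfl⟩ := he.deterministic he'
  exact hv'

/-- A signal consists of a current value and a location: the tail cannot be an input channel, because
the type of an input channel is a value type. -/
theorem LimitRel.sig_cases (hA : A.IsValueType) (h : LimitRel 𝒜 Δ A.sig η v) :
    ∃ u l, v = .cons u (.loc l) ∧ ValueOfType u A ∧
      LimitRel 𝒜 Δ (.delayE A.sig) η (.loc l) := by
  obtain ⟨w, rfl, _⟩ := valRel_fix.1 (h 0)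
  have hw : LimitRel 𝒜 Δ (.prod A (.delayE A.sig)) η w := by
    intro n
    obtain ⟨_, he, hw⟩ := valRel_fix.1 (h n)
    cases he
    rwa [hA.unfold_sig] at hw
  obtain ⟨u, d, rfl, hu, hd⟩ := hw.prod_cases
  rcases (valRel_delayE.1 (hd 0)).1 with ⟨l, rfl⟩ | ⟨κ, c, rfl, hκ⟩
  · exact ⟨u, l, rfl, (hu 0).valueOfType hA, hd⟩
  · cases Δ.isValueType _ _ _ hκ

theorem LimitRel.foldl_prod_cases {As : List Ty} (h : LimitRel 𝒜 Δ (As.foldl .prod A) η v) :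
    ∃ u us, v = List.foldl .pair u us ∧ LimitRel 𝒜 Δ A η u ∧
      List.Forall₂ (fun B w => LimitRel 𝒜 Δ B η w) As us := by
  induction As generalizing A with
  | nil => exact ⟨v, [], rfl, h, .nil⟩
  | cons B As ih =>
    obtain ⟨u, us, rfl, hu, hus⟩ := ih h
    obtain ⟨u₁, u₂, rfl, h₁, h₂⟩ := hu.prod_cases
    exact ⟨u₁, u₂ :: us, rfl, h₁, .cons h₂ hus⟩

theorem LimitRel.tupleTy_cases {As : List Ty} (h : LimitRel 𝒜 Δ (.tupleTy As) η v) :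
    ∃ us, v = .tuple us ∧ List.Forall₂ (fun B w => LimitRel 𝒜 Δ B η w) As us := by
  cases As with
  | nil => exact ⟨[], valRel_unit.1 (h 0), .nil⟩
  | cons A As =>
    obtain ⟨u, us, rfl, hu, hus⟩ := h.foldl_prod_cases
    exact ⟨u :: us, rfl, .cons hu hus⟩

end Signals

/-! ### Runs of the machine -/

/-- The locations in `N` are good delayed signals of the types declared in `D`. -/
def PendingRel (𝒜 : Allocator) (Δ : InputCtx) (η : Heap) (D : List (OutChan × Ty))
    (N : Pending) : Prop :=
  List.Forall₂ (fun d e => d.1 = e.1 ∧ d.2.IsValueType ∧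
    LimitRel 𝒜 Δ (.delayE d.2.sig) η (.loc e.2)) D N

section Machine

variable {𝒜 : Allocator} {Δ : InputCtx} {Γout : OutputCtx}

/-- The entries of the initial result, one for each declared output channel. -/
theorem exists_entries {η : Heap} {D : List (OutChan × Ty)} {us : List Tm}
    (hD : ∀ x A, (x, A) ∈ D → A.IsValueType)
    (h : List.Forall₂ (fun B w => LimitRel 𝒜 Δ B η w) (D.map fun d => d.2.sig) us) :
    ∃ r : List (OutChan × Tm × Loc), r.map (fun e => e.1) = D.map (fun d => d.1) ∧
      us = (r.map fun e => Tm.cons e.2.1 (.loc e.2.2)) ∧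
      PendingRel 𝒜 Δ η D (r.map fun e => (e.1, e.2.2)) ∧
      ∀ x v, (x, v) ∈ r.map (fun e => (e.1, e.2.1)) → ∃ A, (x, A) ∈ D ∧ ValueOfType v A := by
  induction D generalizing us with
  | nil => cases h; exact ⟨[], rfl, rfl, .nil, by simp⟩
  | cons d D ih =>
    cases h with
    | cons hu hus =>
      have hd : d.2.IsValueType := hD d.1 d.2 List.mem_cons_self
      obtain ⟨r, h₁, rfl, h₃, h₄⟩ := ih (fun x A hx => hD x A (List.mem_cons_of_mem _ hx)) hus
      obtain ⟨u, l, rfl, hu, hl⟩ := hu.sig_cases hd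
      refine ⟨(d.1, u, l) :: r, by simp [h₁], rfl, .cons ⟨rfl, hd, hl⟩ h₃, ?_⟩
      intro x v hx
      rcases List.mem_cons.1 hx with hx | hx
      · cases hx
        exact ⟨d.2, List.mem_cons_self, hu⟩
      · obtain ⟨A, hA, hv⟩ := h₄ x v hx
        exact ⟨A, List.mem_cons_of_mem _ hA, hv⟩

theorem exists_init_step {t : Tm} {ι : Buffer} (ht : IsReactiveProgram t Δ Γout)
    (hι : BufferTyped Δ ι) :
    ∃ O N η, Step 𝒜 Γout (.start t ι) (.output O) (.run N (.one η) ι) ∧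
      OutputsTyped Γout O ∧ PendingRel 𝒜 Δ η Γout.decls N := by
  obtain ⟨v, τ, he, hτ, hv⟩ := exists_eval_limitRel (𝒜 := 𝒜) hι fun n =>
    HasType.expRel ht n (.one .empty) .var trivial
  rw [Tm.subst_var] at he
  cases hτ with
  | one =>
    obtain ⟨us, rfl, hus⟩ := hv.tupleTy_cases
    obtain ⟨r, h₁, rfl, h₃, h₄⟩ := exists_entries Γout.isValueType hus
    exact ⟨_, _, _, .init r h₁ he, h₄, h₃⟩

/-- The entries after an input are processed from left to right, and the later heap grows. An entry
that is kept survives the input as its clock does not tick. -/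
theorem exists_output_step {ι : Buffer} {κ : Chan} {w : Tm} {η ηL : Heap}
    {D : List (OutChan × Ty)} {N : Pending} (hι : BufferTyped Δ ι) (hw : InputTyped Δ κ w)
    (hN : PendingRel 𝒜 Δ η D N) (hη : η.clockNotIn κ ≤ ηL) :
    ∃ O N' η', Step 𝒜 Γout (.run N (.two (η.clockIn κ) κ w ηL) ι) (.output O)
        (.run N' (.one η') ι) ∧ ηL ≤ η' ∧ PendingRel 𝒜 Δ η' D N' ∧
      ∀ x v, (x, v) ∈ O → ∃ A, (x, A) ∈ D ∧ ValueOfType v A := by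
  induction hN generalizing ηL with
  | nil => exact ⟨[], [], ηL, .outputEnd, le_rfl, .nil, by simp⟩
  | @cons d e D N h _ ih =>
    obtain ⟨x, A⟩ := d
    obtain ⟨y, l⟩ := e
    obtain ⟨rfl, hA, hl⟩ : x = y ∧ A.IsValueType ∧ LimitRel 𝒜 Δ (.delayE A.sig) η (.loc l) := h
    by_cases hκ : κ ∈ l.clock
    · obtain ⟨v, τ, he, hτ, hv⟩ := exists_eval_limitRel hι fun n =>
        ((valRel_delayE.1 (hl (n + 1))).2 n rfl _ rfl κ w hw η le_rfl ηL hη).1 hκ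
      cases hτ with
      | @two _ _ ηL' _ _ hL =>
        obtain ⟨u, l', rfl, hu, hl'⟩ := hv.sig_cases hA
        obtain ⟨O, N', η', hstep, hη', hN', hO⟩ := ih (hη.trans hL)
        refine ⟨(x, u) :: O, (x, l') :: N', η', .outputCompute hκ he hstep, hL.trans hη',
          .cons ⟨rfl, hA, fun n => (hl' n).mono hη'⟩ hN', ?_⟩
        intro y v hy
        rcases List.mem_cons.1 hy with hy | hy
        · cases hy
          exact ⟨A, List.mem_cons_self, hu⟩
        · obtain ⟨B, hB, hv⟩ := hO y v hy
          exact ⟨B, List.mem_cons_of_mem _ hB, hv⟩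
    · obtain ⟨O, N', η', hstep, hη', hN', hO⟩ := ih hη
      refine ⟨O, (x, l) :: N', η', .outputSkip hκ hstep, hη', .cons ⟨rfl, hA, fun n => ?_⟩ hN', ?_⟩
      · exact ((valRel_delayE.1 (hl (n + 1))).2 n rfl _ rfl κ w hw η le_rfl η'
          (hη.trans hη')).2 hκ
      · intro y v hy
        obtain ⟨B, hB, hv⟩ := hO y v hy
        exact ⟨B, List.mem_cons_of_mem _ hB, hv⟩

theorem BufferTyped.refresh {ι : Buffer} {κ : Chan} {w : Tm} (hι : BufferTyped Δ ι)
    (hw : InputTyped Δ κ w) : BufferTyped Δ (ι.refresh κ w) := by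
  intro κ' c A hκ' hc
  by_cases hs : (ι κ).isSome = true
  · rw [Buffer.refresh, if_pos hs]
    by_cases h : κ' = κ
    · subst h
      obtain ⟨c', A', hκ, hw⟩ := hw
      rw [InputCtx.Has, hκ'] at hκ
      cases hκ
      exact ⟨w, Function.update_self .., hw⟩
    · rw [Function.update_of_ne h]
      exact hι κ' c A hκ' hc
  · rw [Buffer.refresh, if_neg hs]
    exact hι κ' c A hκ' hc

/-- A state of the machine between two steps, together with the outputs of the preceding step,
such that the machine can be continued for any number of inputs. -/
structure GoodState (𝒜 : Allocator) (Δ : InputCtx) (Γout : OutputCtx) where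
  pending : Pending
  heap : Heap
  buffer : Buffer
  outputs : Outputs
  pendingRel : PendingRel 𝒜 Δ heap Γout.decls pending
  bufferTyped : BufferTyped Δ buffer
  outputsTyped : OutputsTyped Γout outputs

theorem GoodState.exists_next (s : GoodState 𝒜 Δ Γout) {κ : Chan} {w : Tm}
    (hw : InputTyped Δ κ w) :
    ∃ s' : GoodState 𝒜 Δ Γout, s'.buffer = s.buffer.refresh κ w ∧
      Step 𝒜 Γout
        (.run s.pending (.two (s.heap.clockIn κ) κ w (s.heap.clockNotIn κ)) s'.buffer)
        (.output s'.outputs) (.run s'.pending (.one s'.heap) s'.buffer) := by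
  have hι := s.bufferTyped.refresh hw
  obtain ⟨O, N', η', hstep, _, hN', hO⟩ := exists_output_step hι hw s.pendingRel le_rfl
  exact ⟨⟨N', η', _, O, hN', hι, hO⟩, rfl, hstep⟩

end Machine

end AsyncRaTT

open AsyncRaTT
theorem mainTheorem2 (𝒜 : Allocator) (Δ : InputCtx) (Γout : OutputCtx) (t : Tm)
    (ht : IsReactiveProgram t Δ Γout)
    (κ : ℕ → Chan) (v : ℕ → Tm) (hv : ∀ i, InputTyped Δ (κ i) (v i))
    (ι₀ : Buffer) (hι₀ : BufferTyped Δ ι₀) :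
    ∃ (ι : ℕ → Buffer) (N : ℕ → Pending) (η : ℕ → Heap) (σ : ℕ → Store) (O : ℕ → Outputs),
      ι 0 = ι₀ ∧
      Step 𝒜 Γout (.start t ι₀) (.output (O 0)) (.run (N 0) (.one (η 0)) (ι 0)) ∧
      (∀ i,
        Step 𝒜 Γout (.run (N i) (.one (η i)) (ι i)) (.input (κ i) (v i))
          (.run (N i) (σ i) (ι (i + 1))) ∧
        Step 𝒜 Γout (.run (N i) (σ i) (ι (i + 1))) (.output (O (i + 1)))
          (.run (N (i + 1)) (.one (η (i + 1))) (ι (i + 1)))) ∧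
      (∀ i, OutputsTyped Γout (O i)) := by
  obtain ⟨O₀, N₀, η₀, hinit, hO₀, hN₀⟩ := exists_init_step (𝒜 := 𝒜) ht hι₀
  choose next hbuffer hstep using fun i (s : GoodState 𝒜 Δ Γout) => s.exists_next (hv i)
  let s : ℕ → GoodState 𝒜 Δ Γout := fun i =>
    Nat.rec ⟨N₀, η₀, ι₀, O₀, hN₀, hι₀, hO₀⟩ next i
  refine ⟨fun i => (s i).buffer, fun i => (s i).pending, fun i => (s i).heap,
    fun i => .two ((s i).heap.clockIn (κ i)) (κ i) (v i) ((s i).heap.clockNotIn (κ i)),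
    fun i => (s i).outputs, rfl, hinit, fun i => ⟨?_, hstep i (s i)⟩,
    fun i => (s i).outputsTyped⟩
  have h : (s (i + 1)).buffer = (s i).buffer.refresh (κ i) (v i) := hbuffer i (s i)
  beta_reduce
  rw [h]
  exact .input
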